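/- Let $k\ge 2$ be an integer. For $\mathbf F\in\{\mathbf R,\mathbf C\}$ let $\Psi(z,w)=\overline{z_0}w_{k+1}+\overline{z_{k+1}}w_0-\sum_{j=1}^k\overline{z_j}w_j$ on $\mathbf F^{k+2}$, a form of signature $(1,k+1)$. Let $\mathsf{SU}(1,k+1)$ be the group of complex matrices of determinant $1$ preserving $\Psi$, and let $\mathsf{SO}_0(1,k+1)$ be the identity component of the group $\mathsf{SO}(1,k+1)$ of real matrices of determinant $1$ preserving $\Psi$. These groups act on the hyperbolic space $\mathbb H^{k+1}_{\mathbf F}$ of $\Psi$-positive lines in $\mathbf F^{k+2}$, with distance given by $\cosh d([z],[w])=|\Psi(z,w)|/\sqrt{\Psi(z,z)\Psi(w,w)}$. A representation $\rho:\Gamma\to\mathsf G$ into one of these groups is convex-cocompact if it has finite kernel and discrete image and if $\Gamma$ acts, through $\rho$, cocompactly on some nonempty closed geodesically convex $\rho(\Gamma)$-invariant subset of $\mathbb H^{k+1}_{\mathbf F}$. A sequence $\rho_n:\Gamma\to\mathsf G$ converges algebraically to $\rho_\infty:\Gamma\to\mathsf G$ if $\rho_n(\gamma)\to\rho_\infty(\gamma)$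 for every $\gamma\in\Gamma$. The geometric limit of the closed subgroups $\rho_n(\Gamma)$ is their limit in the Chabauty topology on the set of closed subgroups of $\mathsf G$, the topology generated by the sets $\{H : H\cap K=\emptyset\}$ with $K\subset\mathsf G$ compact and $\{H : H\cap U\neq\emptyset\}$ with $U\subset\mathsf G$ open. Put $\mathsf G_1=\mathsf{SO}_0(1,k+1)$ and $\mathsf G_2=\mathsf{SU}(1,k+1)$. Then for all integers $l_1,l_2$ with $1\le l_1\le\lfloor k/2\rfloor$ and $1\le l_2\le k$, and for each $i\in\{1,2\}$, there is a sequence $(\rho_n:\mathbf Z\to\mathsf G_i)_{n\in\mathbf N}$ of convex-cocompact representations that converges algebraically to a discrete and faithful representation $\rho_\infty:\mathbf Z\to\mathsf G_i$ and such that the subgroups $\rho_n(\mathbf Z)$ converge geometrically to a closed subgroup $\Gamma_G$ of $\mathsf G_i$ that is isomorphic, as a topological group, to the discrete group $\mathbf Z^{l_i+1}$. -/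

import Mathlib

open Filter Topology Set
open scoped LinearAlgebra.Projectivization Matrix

/-! ## Hyperbolic spaces over `ℝ` and `ℂ` in the projective model -/

section Hyperbolic

variable {𝕜 : Type*} [RCLike 𝕜] {k : ℕ}

/-- The Hermitian form of signature `(1, k+1)` on `𝕜 ^ (k+2)`:
`Ψ(z, w) = conj z₀ * w_{k+1} + conj z_{k+1} * w₀ - ∑ j = 1, …, k, conj z_j * w_j`. -/
def hermForm (z w : Fin (k + 2) → 𝕜) : 𝕜 :=
  star (z 0) * w (Fin.last (k + 1)) + star (z (Fin.last (k + 1))) * w 0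
    - ∑ j : Fin k, star (z j.succ.castSucc) * w j.succ.castSucc

theorem hermForm_smul_smul (a b : 𝕜) (z w : Fin (k + 2) → 𝕜) :
    hermForm (a • z) (b • w) = star a * b * hermForm z w := by
  simp only [hermForm, Pi.smul_apply, smul_eq_mul, star_mul', mul_sub, mul_add, Finset.mul_sum]
  congr 1
  · ring
  · exact Finset.sum_congr rfl fun j _ => by ring

theorem re_hermForm_smul_self (a : 𝕜) (z : Fin (k + 2) → 𝕜) :
    RCLike.re (hermForm (a • z) (a • z)) = ‖a‖ ^ 2 * RCLike.re (hermForm z z) := by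
  rw [hermForm_smul_smul, RCLike.star_def, RCLike.conj_mul, ← RCLike.ofReal_pow,
    RCLike.re_ofReal_mul]

variable (𝕜 k)

/-- The group `SU(1, k+1; 𝕜)` of the matrices of determinant one that preserve the form `Ψ`.
It is `SU(1, k+1)` for `𝕜 = ℂ` and `SO(1, k+1)` for `𝕜 = ℝ`. -/
def SUform : Subgroup (Matrix.SpecialLinearGroup (Fin (k + 2)) 𝕜) where
  carrier := {g | ∀ z w : Fin (k + 2) → 𝕜, hermForm (g.1 *ᵥ z) (g.1 *ᵥ w) = hermForm z w}
  one_mem' := fun z w => by simp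
  mul_mem' := by
    intro g h hg hh z w
    have h1 : (g * h).1 = g.1 * h.1 := rfl
    rw [h1, ← Matrix.mulVec_mulVec, ← Matrix.mulVec_mulVec, hg, hh]
  inv_mem' := by
    intro g hg z w
    have h1 : g.1 * (g⁻¹).1 = 1 := by
      have := congrArg Subtype.val (mul_inv_cancel g)
      exact this
    rw [← hg, Matrix.mulVec_mulVec, Matrix.mulVec_mulVec, h1, Matrix.one_mulVec, Matrix.one_mulVec]

/-- `SO₀(1, k+1)`, the identity component of `SO(1, k+1)`. -/
noncomputable def SO₀ : Subgroup (SUform ℝ k) := Subgroup.connectedComponentOfOne (SUform ℝ k)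

/-- The hyperbolic space of dimension `k+1` over `𝕜`: the lines in `𝕜 ^ (k+2)` on which `Ψ` is
positive. -/
def HypSpace : Type _ :=
  {p : ℙ 𝕜 (Fin (k + 2) → 𝕜) // 0 < RCLike.re (hermForm p.rep p.rep)}

/-- The topology of hyperbolic space as a subspace of the projective space, which has the
quotient topology. -/
instance : TopologicalSpace (HypSpace 𝕜 k) :=
  TopologicalSpace.induced Subtype.val
    (TopologicalSpace.coinduced (Projectivization.mk' 𝕜 (V := Fin (k + 2) → 𝕜)) inferInstance)

variable {𝕜 k}

theorem re_hermForm_rep_mk_pos_iff (v : Fin (k + 2) → 𝕜) (hv : v ≠ 0) :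
    0 < RCLike.re (hermForm (Projectivization.mk 𝕜 v hv).rep (Projectivization.mk 𝕜 v hv).rep) ↔
      0 < RCLike.re (hermForm v v) := by
  obtain ⟨a, ha⟩ := Projectivization.exists_smul_eq_mk_rep 𝕜 v hv
  have hpos : (0 : ℝ) < ‖(a : 𝕜)‖ ^ 2 := by
    have := norm_pos_iff.2 a.ne_zero
    positivity
  rw [← ha, Units.smul_def, re_hermForm_smul_self, mul_pos_iff_of_pos_left hpos]

theorem re_hermForm_rep_smul_pos (g : SUform 𝕜 k) (p : ℙ 𝕜 (Fin (k + 2) → 𝕜))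
    (hp : 0 < RCLike.re (hermForm p.rep p.rep)) :
    0 < RCLike.re (hermForm (g.1 • p).rep (g.1 • p).rep) := by
  have h : g.1 • p = Projectivization.mk 𝕜 (g.1 • p.rep)
      ((smul_ne_zero_iff_ne g.1).mpr p.rep_nonzero) := by
    conv_lhs => rw [← Projectivization.mk_rep p]
    rfl
  rw [h, re_hermForm_rep_mk_pos_iff]
  have h2 : hermForm (g.1 • p.rep) (g.1 • p.rep) = hermForm p.rep p.rep := g.2 p.rep p.rep
  rwa [h2]

/-- The action of the group on hyperbolic space is the linear action on lines. -/
instance : MulAction (SUform 𝕜 k) (HypSpace 𝕜 k) where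
  smul g p := ⟨g.1 • p.1, re_hermForm_rep_smul_pos g p.1 p.2⟩
  one_smul p := Subtype.ext (one_smul _ p.1)
  mul_smul g h p := Subtype.ext (mul_smul g.1 h.1 p.1)

/-- The hyperbolic distance: `cosh d([z], [w]) = |Ψ(z, w)| / √(Ψ(z, z) Ψ(w, w))`. -/
noncomputable def hypDist (p q : HypSpace 𝕜 k) : ℝ :=
  Real.arcosh (‖hermForm p.1.rep q.1.rep‖ /
    √(RCLike.re (hermForm p.1.rep p.1.rep) * RCLike.re (hermForm q.1.rep q.1.rep)))

/-- Geodesic convexity. Hyperbolic space is uniquely geodesic, and the geodesic segment between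
`x` and `y` is the set of all points `p` with `d(x, p) + d(p, y) = d(x, y)`. -/
def HypConvex (C : Set (HypSpace 𝕜 k)) : Prop :=
  ∀ x ∈ C, ∀ y ∈ C, ∀ p, hypDist x p + hypDist p y = hypDist x y → p ∈ C

variable (𝕜 k)

/-- A representation `ρ : Γ → G` into a group of isometries of hyperbolic space is
convex-cocompact if it has finite kernel and discrete image and if `Γ` acts cocompactly on a
nonempty closed convex invariant subset of hyperbolic space. -/
def IsConvexCocompact {Γ G : Type*} [Group Γ] [Group G] [TopologicalSpace G]
    [MulAction G (HypSpace 𝕜 k)] (ρ : Γ →* G) : Prop :=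
  Finite ρ.ker ∧ DiscreteTopology ρ.range ∧
    ∃ C : Set (HypSpace 𝕜 k), C.Nonempty ∧ IsClosed C ∧ HypConvex C ∧
      (∀ γ : Γ, ∀ p ∈ C, ρ γ • p ∈ C) ∧
      ∃ K : Set (HypSpace 𝕜 k), IsCompact K ∧ K ⊆ C ∧ ∀ p ∈ C, ∃ γ : Γ, ∃ q ∈ K, p = ρ γ • q

end Hyperbolic

/-! ## Algebraic and geometric convergence -/

section Convergence

variable {Γ G : Type*} [Group Γ] [Group G] [TopologicalSpace G]

/-- Algebraic convergence of representations: pointwise convergence. -/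
def ConvergesAlgebraically (ρ : ℕ → Γ →* G) (ρ' : Γ →* G) : Prop :=
  ∀ γ : Γ, Tendsto (fun n => ρ n γ) atTop (𝓝 (ρ' γ))

/-- The Chabauty topology on the set of closed subgroups of `G`. -/
@[reducible]
def chabautyTopology (G : Type*) [Group G] [TopologicalSpace G] :
    TopologicalSpace (ClosedSubgroup G) :=
  TopologicalSpace.generateFrom
    ({O | ∃ K : Set G, IsCompact K ∧ O = {H | (H.carrier ∩ K) = ∅}} ∪
      {O | ∃ U : Set G, IsOpen U ∧ O = {H | (H.carrier ∩ U).Nonempty}})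

/-- The images of the representations `ρ n` are closed subgroups that converge in the Chabauty
topology to the closed subgroup `L`. -/
def ConvergesGeometrically (ρ : ℕ → Γ →* G) (L : ClosedSubgroup G) : Prop :=
  ∃ H : ℕ → ClosedSubgroup G, (∀ n, (H n).toSubgroup = (ρ n).range) ∧
    Tendsto H atTop (@nhds _ (chabautyTopology G) L)

/-- A discrete and faithful representation. -/
def IsDiscreteFaithful (ρ : Γ →* G) : Prop :=
  Function.Injective ρ ∧ DiscreteTopology ρ.range

end Convergence

/-! ### Geometric limits of cyclic groups -/

section Framework

/-! Each group is generated by a loxodromic element: a small dilation combined with small rotations,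
conjugated by a translation whose nonzero components all equal a large integer `Q`. One fixed point
at infinity stays put and the other escapes to it as `Q → ∞`, so motions around the far axis look
like translations. Up to a phase, the `m`-th power translates the `j`-th complex component by `Q *
(exp (-s m) - turn (y j * m))`. If `s m` and `y j * m` modulo 1 are close to `η / Q` and `ξ j / Q`,
this is close to `-(η + 2πi ξ j)`.

The rates `y j` and `s` live on different scales. In the real case there are `l` planes, with `y j =
Q^-(j+1)` and `s = Q^-(l+1)`. For `i < l`, the `Q^i`-th power turns the planes before the `i`-th by
whole turns, the `i`-th by `1/Q` and the later ones by `o(1/Q)`. The `Q^l`-th power shows only the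
dilation. The limits are `l` translations in the imaginary directions of the planes and one in the
common real direction, a basis of a lattice of rank `l + 1`.

In the complex case each coordinate is already a plane, but Heisenberg translations commute only
when their Hermitian product is real. Against the common real direction this forces the imaginary
parts to have sum zero and costs one rank, which the vertical direction gives back. The first
rotation number is therefore adjusted so that all of them sum to `Q^-2`, with `y j = Q^-(j+2)` for
`1 ≤ j < l` and `s = Q^-(l+2)`. Then the generator itself tends to a vertical translation, and the
powers with exponents `Q^2, …, Q^(l+1)` supply the other `l` basis elements. Determinant one
requires a further common rotation, of which only a central root of unity survives in the limit.

No further elements accumulate: a power with bounded entries has an exponent close to a multiple of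
every scale, hence one with bounded digits (`exists_digits`), and `exists_cyclic_geometric_limit`
turns this into Chabauty convergence. Convex-cocompactness holds because a loxodromic element acts
cocompactly on its axis (`isConvexCocompact_zpowersHom_conj_lev`). -/

theorem ofAdd_eq_prod_single_zpow {G ι : Type*} [Group G] [Fintype ι] [DecidableEq ι]
    (Φ : Multiplicative (ι → ℤ) →* G) (a : ι → ℤ) (s : List ι) (hs : s.Nodup)
    (hmem : ∀ i, i ∈ s) :
    Φ (.ofAdd a) = (s.map fun i => Φ (.ofAdd (Pi.single i 1)) ^ a i).prod := by
  have h1 : a = (s.map fun i => a i • (Pi.single i 1 : ι → ℤ)).sum := by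
    rw [← List.sum_toFinset _ hs]
    have : s.toFinset = Finset.univ := by ext i; simp [hmem]
    rw [this]
    ext j
    simp [Finset.sum_apply, Pi.single_apply]
  conv_lhs => rw [h1]
  rw [ofAdd_list_prod, map_list_prod, List.map_map, List.map_map]
  congr 1
  refine List.map_congr_left fun i _ => ?_
  simp only [Function.comp_apply]
  rw [ofAdd_zsmul, map_zpow]

/-- A criterion for the geometric convergence of a sequence of cyclic groups to a free abelian
group: suitable powers of the generators converge to a basis, and the powers that stay in a
compact set are words of bounded length in these. -/
theorem exists_cyclic_geometric_limit {G : Type*} [Group G] [TopologicalSpace G]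
    [IsTopologicalGroup G] [T2Space G] {l : ℕ} (g : ℕ → G) (e : ℕ → Fin (l + 1) → ℤ)
    (Φ : Multiplicative (Fin (l + 1) → ℤ) →* G) (he0 : ∀ n, e n 0 = 1)
    (hconv : ∀ i, Tendsto (fun n => g n ^ e n i) atTop (𝓝 (Φ (.ofAdd (Pi.single i 1)))))
    (hprop : ∀ K : Set G, IsCompact K → ∃ C : ℕ, ∀ᶠ n in atTop, ∀ m : ℤ, g n ^ m ∈ K →
      ∃ a : Fin (l + 1) → ℤ, (∀ i, |a i| ≤ C) ∧ m = ∑ i, a i * e n i)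
    (F : G → Fin (l + 1) → ℝ) (hF : Continuous F) (hFΦ : ∀ a i, F (Φ (.ofAdd a)) i = a i)
    (hdisc : ∀ n, DiscreteTopology (zpowersHom G (g n)).range) :
    ∃ (ρ' : Multiplicative ℤ →* G) (L : ClosedSubgroup G),
      ConvergesAlgebraically (fun n => zpowersHom G (g n)) ρ' ∧ IsDiscreteFaithful ρ' ∧
      ConvergesGeometrically (fun n => zpowersHom G (g n)) L ∧
      Nonempty (L.toSubgroup ≃ₜ* Multiplicative (Fin (l + 1) → ℤ)) := by
  have hinj : Function.Injective Φ := by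
    intro a b hab
    have : ∀ i, (a.toAdd i : ℝ) = b.toAdd i := fun i => by
      rw [← hFΦ a.toAdd i, ← hFΦ b.toAdd i]; simp [hab]
    refine Multiplicative.toAdd.injective (funext fun i => by exact_mod_cast this i)
  have hdiscΦ : DiscreteTopology Φ.range := by
    refine discreteTopology_of_isOpen_singleton_one ?_
    -- `F` takes integer values on the range, so this open box isolates the identity.
    have h2 : IsOpen {x : Φ.range | ∀ i, F x.1 i ∈ Ioo (-1 : ℝ) 1} := by
      simp only [ofPred_forall]
      exact isOpen_iInter_of_finite fun i => isOpen_Ioo.preimage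
        ((continuous_apply i).comp (hF.comp continuous_subtype_val))
    convert h2 using 1
    ext ⟨x, a, rfl⟩
    simp only [mem_singleton_iff, mem_ofPred_eq]
    have hx : ∀ i, F (Φ a) i = a.toAdd i := fun i => hFΦ a.toAdd i
    simp only [hx]
    constructor
    · intro h i
      have h3 : Φ a = 1 := congrArg Subtype.val h
      rw [← map_one Φ] at h3
      rw [hinj h3]; simp
    · intro h
      have : a = 1 := by
        refine Multiplicative.toAdd.injective (funext fun i => ?_)
        have := h i
        rw [mem_Ioo] at this
        have h1 : (-1 : ℤ) < a.toAdd i := by exact_mod_cast this.1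
        have h2 : a.toAdd i < 1 := by exact_mod_cast this.2
        simp; omega
      subst this
      simp
  have hconvΦ : ∀ a : Fin (l + 1) → ℤ, Tendsto (fun n => g n ^ (∑ i, a i * e n i)) atTop
      (𝓝 (Φ (.ofAdd a))) := by
    intro a
    rw [ofAdd_eq_prod_single_zpow Φ a _ (List.nodup_finRange _) (List.mem_finRange)]
    have : ∀ n, g n ^ (∑ i, a i * e n i) =
        ((List.finRange (l + 1)).map fun i => (g n ^ e n i) ^ a i).prod := by
      intro n
      -- The same product formula, for the homomorphism `a ↦ g n ^ (∑ i, a i * e n i)`.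
      have := ofAdd_eq_prod_single_zpow ((zpowersHom G (g n)).comp
        (AddMonoidHom.toMultiplicative (∑ i : Fin (l + 1),
          (AddMonoidHom.mulRight (e n i)).comp (Pi.evalAddMonoidHom (fun _ => ℤ) i))))
          a _ (List.nodup_finRange _) (List.mem_finRange)
      simpa [AddMonoidHom.finsetSum_apply, Pi.single_apply, mul_comm] using this
    simp only [this]
    exact tendsto_list_prod _ fun i _ => (hconv i).zpow (a i)
  have hLcl : IsClosed (Φ.range : Set G) := Subgroup.isClosed_of_discrete
  let L : ClosedSubgroup G := ⟨Φ.range, hLcl⟩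
  have hcl : ∀ n, IsClosed ((zpowersHom G (g n)).range : Set G) := fun n =>
    have := hdisc n
    Subgroup.isClosed_of_discrete
  refine ⟨zpowersHom G (Φ (.ofAdd (Pi.single 0 1))), L, ?_, ⟨?_, ?_⟩, ?_, ?_⟩
  · intro γ
    have := hconv 0
    simp only [he0, zpow_one] at this
    simpa using this.zpow γ.toAdd
  · intro a b hab
    simp only [zpowersHom_apply, ← map_zpow, ← ofAdd_zsmul] at hab
    have := congrFun (Multiplicative.ofAdd.injective (hinj hab)) 0
    simpa using this
  · have hle : (zpowersHom G (Φ (.ofAdd (Pi.single 0 1)))).range ≤ Φ.range := by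
      rintro _ ⟨a, rfl⟩
      exact ⟨_, (map_zpow Φ _ a.toAdd)⟩
    exact DiscreteTopology.of_continuous_injective (f := Subgroup.inclusion hle)
      (continuous_subtype_val.subtype_mk _) (Subgroup.inclusion_injective hle)
  · refine ⟨fun n => ⟨(zpowersHom G (g n)).range, hcl n⟩, fun n => rfl, ?_⟩
    refine TopologicalSpace.tendsto_nhds_generateFrom_iff.2 ?_
    rintro _ (⟨K, hK, rfl⟩ | ⟨U, hU, rfl⟩) hL
    · obtain ⟨C, hC⟩ := hprop K hK
      have hL' : ∀ a, Φ (.ofAdd a) ∉ K := fun a ha => by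
        have : Φ (.ofAdd a) ∈ L.carrier ∩ K := ⟨⟨_, rfl⟩, ha⟩
        rw [show L.carrier ∩ K = ∅ from hL] at this
        exact this
      -- Bounded digits leave finitely many words, so convergence word by word is uniform enough to
      -- avoid `K`.
      have hev : ∀ᶠ n in atTop, ∀ a ∈ Fintype.piFinset
          fun _ : Fin (l + 1) => Finset.Icc (-(C : ℤ)) C, g n ^ (∑ i, a i * e n i) ∉ K :=
        (Filter.eventually_all_finset _).2 fun a _ =>
          (hconvΦ a).eventually (hK.isClosed.isOpen_compl.mem_nhds (hL' a))
      filter_upwards [hC, hev] with n h1 h2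
      refine Set.eq_empty_iff_forall_notMem.2 ?_
      rintro _ ⟨⟨m, rfl⟩, hm⟩
      obtain ⟨a, ha, ham⟩ := h1 m.toAdd hm
      refine h2 a ?_ (ham ▸ hm)
      simpa [← abs_le] using ha
    · obtain ⟨_, ⟨a, rfl⟩, haU⟩ := hL
      filter_upwards [(hconvΦ a.toAdd).eventually (hU.mem_nhds haU)] with n hn
      exact ⟨_, ⟨.ofAdd (∑ i, a.toAdd i * e n i), rfl⟩, hn⟩
  · let φ := (MonoidHom.ofInjective hinj).symm
    exact ⟨{ φ with
      continuous_toFun := by exact continuous_of_discreteTopology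
      continuous_invFun := by
        exact continuous_of_discreteTopology (f := (φ.symm : _ → _)) }⟩

end Framework

/-! ### Block upper triangular matrices -/

section Block

variable {𝕜 : Type*} [RCLike 𝕜] {k : ℕ}

/-- The `j`-th of the middle indices. -/
def midx (j : Fin k) : Fin (k + 2) := j.succ.castSucc

/-- The splitting of the index set into the first index, the `k` middle ones and the last. -/
noncomputable def blkEquiv (k : ℕ) : Unit ⊕ (Fin k ⊕ Unit) ≃ Fin (k + 2) :=
  Equiv.ofBijective
    (Sum.elim (fun _ => 0) (Sum.elim midx fun _ => Fin.last (k + 1)))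
    ((Fintype.bijective_iff_injective_and_card _).2 ⟨by
      rintro (x | x | x) (y | y | y) h <;> simp [Fin.ext_iff, midx] at h ⊢ <;> omega, by
      simp; omega⟩)

theorem blkEquiv_inl (k : ℕ) : blkEquiv k (.inl ()) = 0 := rfl

theorem blkEquiv_mid (j : Fin k) : blkEquiv k (.inr (.inl j)) = midx j := rfl

theorem blkEquiv_inr (k : ℕ) : blkEquiv k (.inr (.inr ())) = Fin.last (k + 1) := rfl

@[simp] theorem midx_inj {i j : Fin k} : midx i = midx j ↔ i = j := by
  simp [midx]

@[simp] theorem midx_ne_zero (i : Fin k) : midx i ≠ 0 := by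
  simp [midx, Fin.ext_iff]

@[simp] theorem zero_ne_midx (i : Fin k) : 0 ≠ midx i := (midx_ne_zero i).symm

@[simp] theorem midx_ne_last (i : Fin k) : midx i ≠ Fin.last (k + 1) := by
  simp [midx, Fin.ext_iff]; omega

@[simp] theorem last_ne_midx (i : Fin k) : Fin.last (k + 1) ≠ midx i := (midx_ne_last i).symm

theorem blk_forall {P : Fin (k + 2) → Prop} (h0 : P 0) (hm : ∀ j : Fin k, P (midx j))
    (hl : P (Fin.last (k + 1))) (i : Fin (k + 2)) : P i := by
  obtain ⟨(x | x | x), rfl⟩ := (blkEquiv k).surjective i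
  exacts [h0, hm x, hl]

theorem blk_sum {M : Type*} [AddCommMonoid M] (f : Fin (k + 2) → M) :
    ∑ i, f i = f 0 + (∑ j : Fin k, f (midx j) + f (Fin.last (k + 1))) := by
  rw [← (blkEquiv k).sum_comp, Fintype.sum_sum_type, Fintype.sum_sum_type]
  simp [blkEquiv_inl, blkEquiv_mid, blkEquiv_inr]

/-- The middle coordinates of a vector. -/
def mid (z : Fin (k + 2) → 𝕜) : Fin k → 𝕜 := fun j => z (midx j)

theorem hermForm_eq (z w : Fin (k + 2) → 𝕜) : hermForm z w =
    star (z 0) * w (Fin.last (k + 1)) + star (z (Fin.last (k + 1))) * w 0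
      - star (mid z) ⬝ᵥ mid w := rfl

/-- The block upper triangular matrices with respect to the splitting `1 + k + 1`. -/
noncomputable def blk (a : 𝕜) (r : Fin k → 𝕜) (β : 𝕜) (A : Matrix (Fin k) (Fin k) 𝕜)
    (τ : Fin k → 𝕜) (b : 𝕜) : Matrix (Fin (k + 2)) (Fin (k + 2)) 𝕜 :=
  (Matrix.fromBlocks (Matrix.of fun _ _ => a) (Matrix.of fun _ => Sum.elim r fun _ => β) 0
    (Matrix.fromBlocks A (Matrix.of fun i _ => τ i) 0 (Matrix.of fun _ _ => b))).submatrix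
      (blkEquiv k).symm (blkEquiv k).symm

variable (a : 𝕜) (r : Fin k → 𝕜) (β : 𝕜) (A : Matrix (Fin k) (Fin k) 𝕜) (τ : Fin k → 𝕜) (b : 𝕜)

@[simp] theorem blk_zero_zero : blk a r β A τ b 0 0 = a := by
  simp [blk, ← blkEquiv_inl]

@[simp] theorem blk_zero_mid (j : Fin k) : blk a r β A τ b 0 (midx j) = r j := by
  simp [blk, ← blkEquiv_inl, ← blkEquiv_mid]

@[simp] theorem blk_zero_last : blk a r β A τ b 0 (Fin.last (k + 1)) = β := by
  simp [blk, ← blkEquiv_inl, ← blkEquiv_inr]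

@[simp] theorem blk_mid_zero (i : Fin k) : blk a r β A τ b (midx i) 0 = 0 := by
  simp [blk, ← blkEquiv_inl, ← blkEquiv_mid]

@[simp] theorem blk_mid_mid (i j : Fin k) :
    blk a r β A τ b (midx i) (midx j) = A i j := by
  simp [blk, ← blkEquiv_mid]

@[simp] theorem blk_mid_last (i : Fin k) :
    blk a r β A τ b (midx i) (Fin.last (k + 1)) = τ i := by
  simp [blk, ← blkEquiv_inr, ← blkEquiv_mid]

@[simp] theorem blk_last_zero : blk a r β A τ b (Fin.last (k + 1)) 0 = 0 := by
  simp [blk, ← blkEquiv_inl, ← blkEquiv_inr]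

@[simp] theorem blk_last_mid (j : Fin k) :
    blk a r β A τ b (Fin.last (k + 1)) (midx j) = 0 := by
  simp [blk, ← blkEquiv_inr, ← blkEquiv_mid]

@[simp] theorem blk_last_last : blk a r β A τ b (Fin.last (k + 1)) (Fin.last (k + 1)) = b := by
  simp [blk, ← blkEquiv_inr]

theorem det_blk : (blk a r β A τ b).det = a * (A.det * b) := by
  simp [blk, Matrix.det_submatrix_equiv_self, Matrix.det_fromBlocks_zero₂₁]

theorem blk_one : blk 1 0 0 1 0 1 = (1 : Matrix (Fin (k + 2)) (Fin (k + 2)) 𝕜) := by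
  ext i j
  induction i using blk_forall <;> induction j using blk_forall <;>
    simp [Matrix.one_apply]

theorem blk_mul (a' : 𝕜) (r' : Fin k → 𝕜) (β' : 𝕜) (A' : Matrix (Fin k) (Fin k) 𝕜)
    (τ' : Fin k → 𝕜) (b' : 𝕜) : blk a r β A τ b * blk a' r' β' A' τ' b' =
    blk (a * a') (a • r' + r ᵥ* A') (a * β' + (r ⬝ᵥ τ' + β * b')) (A * A') (A *ᵥ τ' + b' • τ)
      (b * b') := by
  ext i j
  rw [Matrix.mul_apply, blk_sum]
  induction i using blk_forall <;> induction j using blk_forall <;>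
    simp [Matrix.mul_apply, Matrix.vecMul, Matrix.mulVec, dotProduct, mul_comm]

theorem blk_mulVec_zero (z : Fin (k + 2) → 𝕜) : (blk a r β A τ b *ᵥ z) 0 =
    a * z 0 + (r ⬝ᵥ mid z + β * z (Fin.last (k + 1))) := by
  simp [Matrix.mulVec, dotProduct, blk_sum, mid]

theorem mid_blk_mulVec (z : Fin (k + 2) → 𝕜) : mid (blk a r β A τ b *ᵥ z) =
    A *ᵥ mid z + z (Fin.last (k + 1)) • τ := by
  ext j
  simp [Matrix.mulVec, dotProduct, blk_sum, mid, mul_comm]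

theorem blk_mulVec_last (z : Fin (k + 2) → 𝕜) : (blk a r β A τ b *ᵥ z) (Fin.last (k + 1)) =
    b * z (Fin.last (k + 1)) := by
  simp [Matrix.mulVec, dotProduct, blk_sum]

theorem continuous_blk {X : Type*} [TopologicalSpace X] {a : X → 𝕜} {r : X → Fin k → 𝕜}
    {β : X → 𝕜} {A : X → Matrix (Fin k) (Fin k) 𝕜} {τ : X → Fin k → 𝕜} {b : X → 𝕜}
    (ha : Continuous a) (hr : Continuous r) (hβ : Continuous β) (hA : Continuous A)
    (hτ : Continuous τ) (hb : Continuous b) :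
    Continuous fun x => blk (a x) (r x) (β x) (A x) (τ x) (b x) := by
  refine continuous_matrix fun i j => ?_
  induction i using blk_forall <;> induction j using blk_forall <;> simp <;>
    fun_prop

theorem tendsto_blk {X : Type*} {f : Filter X} {a : X → 𝕜} {r : X → Fin k → 𝕜}
    {β : X → 𝕜} {A : X → Matrix (Fin k) (Fin k) 𝕜} {τ : X → Fin k → 𝕜} {b : X → 𝕜}
    {a' : 𝕜} {r' : Fin k → 𝕜} {β' : 𝕜} {A' : Matrix (Fin k) (Fin k) 𝕜}
    {τ' : Fin k → 𝕜} {b' : 𝕜}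
    (ha : Tendsto a f (𝓝 a')) (hr : ∀ j, Tendsto (r · j) f (𝓝 (r' j))) (hβ : Tendsto β f (𝓝 β'))
    (hA : ∀ i j, Tendsto (A · i j) f (𝓝 (A' i j))) (hτ : ∀ j, Tendsto (τ · j) f (𝓝 (τ' j)))
    (hb : Tendsto b f (𝓝 b')) :
    Tendsto (fun x => blk (a x) (r x) (β x) (A x) (τ x) (b x)) f
      (𝓝 (blk a' r' β' A' τ' b')) := by
  refine tendsto_pi_nhds.2 fun i => tendsto_pi_nhds.2 fun j => ?_
  induction i using blk_forall <;> induction j using blk_forall <;>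
    simp [*, tendsto_const_nhds]

end Block

/-! ### Heisenberg translations, dilations and rotations -/

section Elements

variable {𝕜 : Type*} [RCLike 𝕜] {k : ℕ}

/-- The element of `SUform` with a given matrix. -/
def SUform.mk (M : Matrix (Fin (k + 2)) (Fin (k + 2)) 𝕜) (hdet : M.det = 1)
    (h : ∀ z w, hermForm (M *ᵥ z) (M *ᵥ w) = hermForm z w) : SUform 𝕜 k := ⟨⟨M, hdet⟩, h⟩

theorem SUform.ext {g h : SUform 𝕜 k} (H : g.1.1 = h.1.1) : g = h :=
  Subtype.ext (Subtype.ext H)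

theorem SUform.mul_val (g h : SUform 𝕜 k) : (g * h).1.1 = g.1.1 * h.1.1 := rfl

theorem SUform.one_val : (1 : SUform 𝕜 k).1.1 = 1 := rfl

theorem SUform.isInducing_val : IsInducing fun g : SUform 𝕜 k => g.1.1 := by
  have h : IsInducing fun g : Matrix.SpecialLinearGroup (Fin (k + 2)) 𝕜 => g.1 := ⟨rfl⟩
  exact h.comp IsInducing.subtypeVal

theorem SUform.tendsto_iff {X : Type*} {f : Filter X} {g : X → SUform 𝕜 k} {h : SUform 𝕜 k} :
    Tendsto g f (𝓝 h) ↔ Tendsto (fun x => (g x).1.1) f (𝓝 h.1.1) :=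
  SUform.isInducing_val.tendsto_nhds_iff

theorem SUform.continuous_iff {X : Type*} [TopologicalSpace X] {g : X → SUform 𝕜 k} :
    Continuous g ↔ Continuous fun x => (g x).1.1 :=
  SUform.isInducing_val.continuous_iff

theorem SUform.continuous_apply (i j : Fin (k + 2)) :
    Continuous fun g : SUform 𝕜 k => g.1.1 i j :=
  (SUform.continuous_iff.1 continuous_id).matrix_elem i j

theorem SUform.exists_norm_le {K : Set (SUform 𝕜 k)} (hK : IsCompact K) :
    ∃ R : ℝ, 0 < R ∧ ∀ g ∈ K, ∀ i j, ‖g.1.1 i j‖ ≤ R := by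
  choose f hf using fun p : Fin (k + 2) × Fin (k + 2) =>
    hK.exists_bound_of_continuousOn (SUform.continuous_apply (𝕜 := 𝕜) p.1 p.2).continuousOn
  refine ⟨∑ p, |f p| + 1, by positivity, fun g hg i j => ?_⟩
  have h1 := Finset.single_le_sum (f := fun p => |f p|) (fun p _ => abs_nonneg _)
    (Finset.mem_univ (i, j))
  have h2 := hf (i, j) g hg
  have h3 := le_abs_self (f (i, j))
  simp only at h1 h2
  linarith

/-- The top right entry of a Heisenberg translation. -/
noncomputable def horHeight (τ : Fin k → 𝕜) (t : ℝ) : 𝕜 := star τ ⬝ᵥ τ / 2 + t * RCLike.I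

theorem star_dotProduct_self (τ : Fin k → 𝕜) :
    star τ ⬝ᵥ τ = ((∑ j, ‖τ j‖ ^ 2 : ℝ) : 𝕜) := by
  simp [dotProduct, RCLike.conj_mul]

theorem horHeight_add_star (τ : Fin k → 𝕜) (t : ℝ) :
    horHeight τ t + star (horHeight τ t) = star τ ⬝ᵥ τ := by
  simp only [horHeight, star_dotProduct_self]
  simp
  ring

/-- The Heisenberg translations. -/
noncomputable def hor (τ : Fin k → 𝕜) (t : ℝ) : SUform 𝕜 k :=
  SUform.mk (blk 1 (star τ) (horHeight τ t) 1 τ 1) (by simp [det_blk]) (by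
    intro z w
    have h := horHeight_add_star τ t
    simp only [hermForm_eq, blk_mulVec_zero, mid_blk_mulVec, blk_mulVec_last, one_mul,
      Matrix.one_mulVec, star_add, star_mul', star_smul, add_dotProduct, dotProduct_add,
      smul_dotProduct, dotProduct_smul, smul_eq_mul, ← h]
    rw [show star (star τ ⬝ᵥ mid z) = star (mid z) ⬝ᵥ τ from by
      rw [Matrix.star_dotProduct, star_star]]
    ring)

theorem hor_val (τ : Fin k → 𝕜) (t : ℝ) :
    (hor τ t).1.1 = blk 1 (star τ) (horHeight τ t) 1 τ 1 := rfl

/-- The Heisenberg cocycle is the imaginary part of the Hermitian product of the two vectors; the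
hypothesis makes it vanish. -/
theorem hor_mul (τ τ' : Fin k → 𝕜) (t t' : ℝ) (h : star τ ⬝ᵥ τ' = star τ' ⬝ᵥ τ) :
    hor τ t * hor τ' t' = hor (τ + τ') (t + t') := by
  refine SUform.ext ?_
  rw [SUform.mul_val, hor_val, hor_val, hor_val, blk_mul]
  congr 1
  · simp
  · ext; simp [add_comm]
  · simp only [horHeight, star_add, add_dotProduct, dotProduct_add, h]
    push_cast
    ring
  · simp
  · simp [add_comm]
  · simp

theorem hor_zero : hor (0 : Fin k → 𝕜) 0 = 1 := by
  refine SUform.ext ?_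
  rw [hor_val, SUform.one_val, ← blk_one]
  simp [horHeight]

theorem hor_inv (τ : Fin k → 𝕜) (t : ℝ) : (hor τ t)⁻¹ = hor (-τ) (-t) := by
  rw [inv_eq_iff_mul_eq_one, hor_mul _ _ _ _ (by simp)]
  simp [hor_zero]

/-- The block diagonal elements, the product of a dilation and a rotation. -/
noncomputable def lev (a b : 𝕜) (A : Matrix (Fin k) (Fin k) 𝕜) (hab : star a * b = 1)
    (hA : Aᴴ * A = 1) (hdet : a * (A.det * b) = 1) : SUform 𝕜 k :=
  SUform.mk (blk a 0 0 A 0 b) (by simpa [det_blk]) (by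
    intro z w
    have hba : star b * a = 1 := by
      have := congrArg star hab
      simpa [mul_comm] using this
    have : star (A *ᵥ mid z) ⬝ᵥ (A *ᵥ mid w) = star (mid z) ⬝ᵥ mid w := by
      rw [Matrix.star_mulVec, Matrix.dotProduct_mulVec, Matrix.vecMul_vecMul, hA,
        Matrix.vecMul_one]
    simp only [hermForm_eq, blk_mulVec_zero, mid_blk_mulVec, blk_mulVec_last, smul_zero,
      zero_dotProduct, zero_mul, add_zero, this, star_mul']
    linear_combination (star (z 0) * w (Fin.last (k + 1))) * hab +
      (star (z (Fin.last (k + 1))) * w 0) * hba)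

/-- Conjugation keeps the diagonal blocks and moves one fixed point from the last basis line to its
image under `hor p 0`. All dependence on `p` sits in the remaining blocks, whose behaviour for large
`p` decides convergence and boundedness. -/
theorem hor_mul_lev_mul_hor_inv (p : Fin k → 𝕜) (a b : 𝕜) (A : Matrix (Fin k) (Fin k) 𝕜)
    (hab : star a * b = 1) (hA : Aᴴ * A = 1) (hdet : a * (A.det * b) = 1) :
    (hor p 0 * lev a b A hab hA hdet * (hor p 0)⁻¹).1.1 =
      blk a (star p ᵥ* A - a • star p) ((a + b) * (star p ⬝ᵥ p / 2) - star p ⬝ᵥ (A *ᵥ p)) A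
        (b • p - A *ᵥ p) b := by
  rw [hor_inv, SUform.mul_val, SUform.mul_val, hor_val, hor_val, lev, SUform.mk, blk_mul, blk_mul]
  congr 1
  · simp
  · ext j; simp; ring
  · simp [horHeight, Matrix.dotProduct_mulVec]; ring
  · simp
  · ext j; simp [Matrix.mulVec_neg]; ring
  · simp

end Elements

/-! ### Points and distances in hyperbolic space -/

section HypPoints

variable {𝕜 : Type*} [RCLike 𝕜] {k : ℕ}

theorem ne_zero_of_re_hermForm_pos {v : Fin (k + 2) → 𝕜} (hv : 0 < RCLike.re (hermForm v v)) :
    v ≠ 0 := by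
  rintro rfl
  simp [hermForm] at hv

/-- The point of hyperbolic space that is spanned by a positive vector. -/
def hypPt (v : Fin (k + 2) → 𝕜) (hv : 0 < RCLike.re (hermForm v v)) : HypSpace 𝕜 k :=
  ⟨Projectivization.mk 𝕜 v (ne_zero_of_re_hermForm_pos hv),
    (re_hermForm_rep_mk_pos_iff v _).2 hv⟩

theorem hypPt_rep (p : HypSpace 𝕜 k) : hypPt p.1.rep p.2 = p :=
  Subtype.ext p.1.mk_rep

theorem hypPt_eq {v w : Fin (k + 2) → 𝕜} (hv : 0 < RCLike.re (hermForm v v))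
    (hw : 0 < RCLike.re (hermForm w w)) (c : 𝕜) (h : c • w = v) : hypPt v hv = hypPt w hw :=
  Subtype.ext ((Projectivization.mk_eq_mk_iff' 𝕜 _ _ _ _).2 ⟨c, h⟩)

theorem exists_smul_eq_rep_hypPt (v : Fin (k + 2) → 𝕜) (hv : 0 < RCLike.re (hermForm v v)) :
    ∃ c : 𝕜, c ≠ 0 ∧ (hypPt v hv).1.rep = c • v := by
  obtain ⟨a, ha⟩ := Projectivization.exists_smul_eq_mk_rep 𝕜 v (ne_zero_of_re_hermForm_pos hv)
  exact ⟨a, a.ne_zero, ha.symm⟩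

theorem smul_hypPt (g : SUform 𝕜 k) (v : Fin (k + 2) → 𝕜) (hv : 0 < RCLike.re (hermForm v v)) :
    g • hypPt v hv = hypPt (g.1.1 *ᵥ v) (by rwa [g.2]) := rfl

theorem hypDist_hypPt {v w : Fin (k + 2) → 𝕜} (hv : 0 < RCLike.re (hermForm v v))
    (hw : 0 < RCLike.re (hermForm w w)) : hypDist (hypPt v hv) (hypPt w hw) =
      Real.arcosh (‖hermForm v w‖ /
        √(RCLike.re (hermForm v v) * RCLike.re (hermForm w w))) := by
  obtain ⟨a, ha, hav⟩ := exists_smul_eq_rep_hypPt v hv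
  obtain ⟨b, hb, hbw⟩ := exists_smul_eq_rep_hypPt w hw
  have ha' := norm_pos_iff.2 ha
  have hb' := norm_pos_iff.2 hb
  rw [hypDist, hav, hbw, re_hermForm_smul_self, re_hermForm_smul_self, hermForm_smul_smul,
    norm_mul, norm_mul, norm_star,
    show ‖a‖ ^ 2 * RCLike.re (hermForm v v) * (‖b‖ ^ 2 * RCLike.re (hermForm w w)) =
      (‖a‖ * ‖b‖) ^ 2 * (RCLike.re (hermForm v v) * RCLike.re (hermForm w w)) by ring,
    Real.sqrt_mul (by positivity), Real.sqrt_sq (by positivity),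
    mul_div_mul_left _ _ (by positivity)]

theorem hypDist_smul_smul (g : SUform 𝕜 k) (p q : HypSpace 𝕜 k) :
    hypDist (g • p) (g • q) = hypDist p q := by
  rw [← hypPt_rep p, ← hypPt_rep q, smul_hypPt, smul_hypPt, hypDist_hypPt, hypDist_hypPt,
    g.2, g.2, g.2]

theorem hypDist_comm (p q : HypSpace 𝕜 k) : hypDist p q = hypDist q p := by
  have h : hermForm p.1.rep q.1.rep = star (hermForm q.1.rep p.1.rep) := by
    simp only [hermForm_eq, star_sub, star_add, star_mul', star_star]
    rw [Matrix.star_dotProduct]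
    ring
  rw [hypDist, hypDist, h, norm_star, mul_comm (RCLike.re _)]

theorem continuous_hypPt {X : Type*} [TopologicalSpace X] {f : X → Fin (k + 2) → 𝕜}
    (hf : Continuous f) (h : ∀ x, 0 < RCLike.re (hermForm (f x) (f x))) :
    Continuous fun x => hypPt (f x) (h x) := by
  let _ : TopologicalSpace (ℙ 𝕜 (Fin (k + 2) → 𝕜)) :=
    TopologicalSpace.coinduced (Projectivization.mk' 𝕜 (V := Fin (k + 2) → 𝕜)) inferInstance
  refine continuous_induced_rng.2 ?_
  exact continuous_coinduced_rng.comp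
    (hf.subtype_mk fun x => ne_zero_of_re_hermForm_pos (h x))

end HypPoints

/-! ### The axis in homogeneous coordinates -/

section Axis

variable {𝕜 : Type*} [RCLike 𝕜] {k : ℕ}

/-- The nonnegative multiples of the vectors `(t, 0, …, 0, 1)` with `t ≥ 0`, together with the
multiples of `(1, 0, …, 0)`. -/
def InAxisCone (v : Fin (k + 2) → 𝕜) : Prop :=
  mid v = 0 ∧ RCLike.im (star (v 0) * v (Fin.last (k + 1))) = 0 ∧
    0 ≤ RCLike.re (star (v 0) * v (Fin.last (k + 1)))

theorem InAxisCone.smul {v : Fin (k + 2) → 𝕜} (hv : InAxisCone v) (c : 𝕜) :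
    InAxisCone (c • v) := by
  obtain ⟨h0, h1, h2⟩ := hv
  have h : star ((c • v) 0) * (c • v) (Fin.last (k + 1)) =
      ((‖c‖ ^ 2 : ℝ) : 𝕜) * (star (v 0) * v (Fin.last (k + 1))) := by
    simp only [Pi.smul_apply, smul_eq_mul, star_mul']
    rw [RCLike.ofReal_pow, ← RCLike.conj_mul, RCLike.star_def]
    ring
  refine ⟨?_, ?_, ?_⟩
  · ext j
    simpa [mid] using Or.inr (congrFun h0 j)
  · rw [h, RCLike.im_ofReal_mul, h1, mul_zero]
  · rw [h, RCLike.re_ofReal_mul]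
    positivity

theorem inAxisCone_smul_iff {v : Fin (k + 2) → 𝕜} {c : 𝕜} (hc : c ≠ 0) :
    InAxisCone (c • v) ↔ InAxisCone v :=
  ⟨fun h => by simpa [smul_smul, hc] using h.smul c⁻¹, fun h => h.smul c⟩

/-- The vector `(t, 0, …, 0, 1)`. -/
def axisVec (t : ℝ) : Fin (k + 2) → 𝕜 :=
  fun i => if i = 0 then (t : 𝕜) else if i = Fin.last (k + 1) then 1 else 0

@[simp] theorem axisVec_zero (t : ℝ) : (axisVec t : Fin (k + 2) → 𝕜) 0 = t := by simp [axisVec]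

@[simp] theorem axisVec_last (t : ℝ) : (axisVec t : Fin (k + 2) → 𝕜) (Fin.last (k + 1)) = 1 := by
  simp [axisVec, Fin.ext_iff]

@[simp] theorem mid_axisVec (t : ℝ) : mid (axisVec t : Fin (k + 2) → 𝕜) = 0 := by
  ext; simp [axisVec, mid]

theorem hermForm_axisVec (t : ℝ) (v : Fin (k + 2) → 𝕜) :
    hermForm (axisVec t) v = t * v (Fin.last (k + 1)) + v 0 := by
  simp [hermForm_eq]

theorem re_hermForm_axisVec_pos {t : ℝ} (ht : 0 < t) : 0 < RCLike.re
    (hermForm (k := k) (axisVec t) (axisVec t) : 𝕜) := by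
  rw [hermForm_axisVec]
  simpa

end Axis

/-! ### Distances to the axis and its convexity -/

section AxisMetric

variable {𝕜 : Type*} [RCLike 𝕜] {k : ℕ}

theorem re_hermForm_self (v : Fin (k + 2) → 𝕜) : RCLike.re (hermForm v v) =
    2 * RCLike.re (star (v 0) * v (Fin.last (k + 1))) - ∑ j, ‖mid v j‖ ^ 2 := by
  rw [hermForm_eq, star_dotProduct_self]
  simp only [map_sub, map_add, RCLike.ofReal_re]
  have : RCLike.re (star (v (Fin.last (k + 1))) * v 0) =
      RCLike.re (star (v 0) * v (Fin.last (k + 1))) := by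
    simp; ring
  rw [this]; ring

theorem norm_hermForm_axisVec_sq (t : ℝ) (v : Fin (k + 2) → 𝕜) :
    ‖hermForm (axisVec t) v‖ ^ 2 = t ^ 2 * ‖v (Fin.last (k + 1))‖ ^ 2 + ‖v 0‖ ^ 2 +
      2 * t * RCLike.re (star (v 0) * v (Fin.last (k + 1))) := by
  rw [hermForm_axisVec, ← RCLike.normSq_eq_def', ← RCLike.normSq_eq_def',
    ← RCLike.normSq_eq_def', RCLike.normSq_apply, RCLike.normSq_apply, RCLike.normSq_apply]
  simp
  ring

/-- The ratio of the norms of the extreme coordinates: the parameter of the projection of a point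
to the axis. -/
noncomputable def axisCoord (v : Fin (k + 2) → 𝕜) : ℝ := ‖v 0‖ / ‖v (Fin.last (k + 1))‖

theorem re_mul_le (v : Fin (k + 2) → 𝕜) : RCLike.re (star (v 0) * v (Fin.last (k + 1))) ≤
    ‖v 0‖ * ‖v (Fin.last (k + 1))‖ := by
  simpa using RCLike.re_le_norm (star (v 0) * v (Fin.last (k + 1)))

theorem norm_pos_of_re_hermForm_pos {v : Fin (k + 2) → 𝕜} (hv : 0 < RCLike.re (hermForm v v)) :
    0 < ‖v 0‖ ∧ 0 < ‖v (Fin.last (k + 1))‖ := by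
  have h1 := re_hermForm_self v
  have h2 := re_mul_le v
  have h3 : 0 ≤ ∑ j, ‖mid v j‖ ^ 2 := by positivity
  have h4 : 0 < ‖v 0‖ * ‖v (Fin.last (k + 1))‖ := by linarith
  exact ⟨pos_of_mul_pos_left h4 (norm_nonneg _), pos_of_mul_pos_right h4 (norm_nonneg _)⟩

/-- The reverse inequality always holds, through `re_mul_le` and the sign of the middle term.
Equality in both kills the middle coordinates and makes the product of the extreme ones real and
nonnegative. -/
theorem inAxisCone_of_re_hermForm_eq {v : Fin (k + 2) → 𝕜}
    (hv : 2 * (‖v 0‖ * ‖v (Fin.last (k + 1))‖) ≤ RCLike.re (hermForm v v)) : InAxisCone v := by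
  have h1 := re_hermForm_self v
  have h2 := re_mul_le v
  have h3 : 0 ≤ ∑ j, ‖mid v j‖ ^ 2 := by positivity
  have h4 : ∑ j, ‖mid v j‖ ^ 2 = 0 := by linarith
  have h5 : RCLike.re (star (v 0) * v (Fin.last (k + 1))) = ‖v 0‖ * ‖v (Fin.last (k + 1))‖ := by
    linarith
  refine ⟨?_, ?_, ?_⟩
  · ext j
    have := (Finset.sum_eq_zero_iff_of_nonneg fun j _ => by positivity).1 h4 j (Finset.mem_univ _)
    simpa using this
  · have h6 := RCLike.norm_sq_eq_def (z := star (v 0) * v (Fin.last (k + 1)))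
    rw [h5, norm_mul, norm_star] at h6
    nlinarith
  · rw [h5]; positivity

theorem cosh_half_log_sq {z : ℝ} (hz : 0 < z) :
    Real.cosh (|Real.log z| / 2) ^ 2 = (z + 1) ^ 2 / (4 * z) := by
  have h := Real.cosh_two_mul (|Real.log z| / 2)
  rw [show 2 * (|Real.log z| / 2) = |Real.log z| by ring, Real.cosh_abs, Real.cosh_log hz,
    Real.sinh_sq] at h
  field_simp at h ⊢
  linarith

/-- A quantitative projection inequality: the defect on the right is nonnegative and vanishes only
on the axis cone. The two sides differ by `(2 * ρ - W) / (2 * W)`, which is nonnegative since `W ≤ 2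
* ρ`. -/
theorem hypDist_axisVec_sq_sub {t : ℝ} (ht : 0 < t) {v : Fin (k + 2) → 𝕜}
    (hv : 0 < RCLike.re (hermForm v v)) :
    ∃ c : ℝ, 0 < c ∧ (‖hermForm (axisVec t) v‖ / √(RCLike.re
      (hermForm (k := k) (axisVec t) (axisVec t) : 𝕜) * RCLike.re (hermForm v v))) ^ 2 -
      Real.cosh (|Real.log (t / axisCoord v)| / 2) ^ 2 ≥
        c * (2 * (‖v 0‖ * ‖v (Fin.last (k + 1))‖) - RCLike.re (hermForm v v)) := by
  obtain ⟨ha, hb⟩ := norm_pos_of_re_hermForm_pos hv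
  have h1 := re_hermForm_self v
  have h3 : 0 ≤ ∑ j, ‖mid v j‖ ^ 2 := by positivity
  have h6 : RCLike.re (hermForm (k := k) (axisVec t) (axisVec t) : 𝕜) = 2 * t := by
    rw [hermForm_axisVec]; simp; ring
  rw [cosh_half_log_sq (by unfold axisCoord; positivity), div_pow, Real.sq_sqrt (by
    rw [h6]; positivity), norm_hermForm_axisVec_sq, h6, axisCoord]
  set a := ‖v 0‖
  set b := ‖v (Fin.last (k + 1))‖
  set ρ := RCLike.re (star (v 0) * v (Fin.last (k + 1)))
  set W := RCLike.re (hermForm v v)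
  have h7 : W ≤ 2 * ρ := by linarith
  refine ⟨(t ^ 2 * b ^ 2 + a ^ 2) / (4 * t * a * b * W), by positivity, ?_⟩
  have h8 : (t ^ 2 * b ^ 2 + a ^ 2 + 2 * t * ρ) / (2 * t * W) -
      (t / (a / b) + 1) ^ 2 / (4 * (t / (a / b))) -
      (t ^ 2 * b ^ 2 + a ^ 2) / (4 * t * a * b * W) * (2 * (a * b) - W) =
      (2 * ρ - W) / (2 * W) := by
    field_simp
    ring
  have h9 : 0 ≤ (2 * ρ - W) / (2 * W) := div_nonneg (by linarith) (by positivity)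
  linarith

theorem half_log_lt_hypDist {t : ℝ} (ht : 0 < t) {v : Fin (k + 2) → 𝕜}
    (hv : 0 < RCLike.re (hermForm v v)) (hcone : ¬ InAxisCone v) :
    |Real.log (t / axisCoord v)| / 2 <
      hypDist (hypPt (axisVec t) (re_hermForm_axisVec_pos ht)) (hypPt v hv) := by
  obtain ⟨c, hc, h⟩ := hypDist_axisVec_sq_sub ht hv
  have h4 : 0 < c * (2 * (‖v 0‖ * ‖v (Fin.last (k + 1))‖) - RCLike.re (hermForm v v)) :=
    mul_pos hc (by
      by_contra h
      exact hcone (inAxisCone_of_re_hermForm_eq (by linarith)))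
  have h5 := (le_abs_self _).trans_lt
    (abs_lt_of_sq_lt_sq (sub_pos.1 (h4.trans_le h)) (by positivity))
  rw [hypDist_hypPt, ← Real.arcosh_cosh (x := |Real.log (t / axisCoord v)| / 2) (by positivity)]
  exact (Real.arcosh_lt_arcosh (Real.cosh_pos _) ((Real.cosh_pos _).trans h5)).2 h5

theorem hypDist_axisVec_axisVec {t t' : ℝ} (ht : 0 < t) (ht' : 0 < t') :
    hypDist (hypPt (𝕜 := 𝕜) (k := k) (axisVec t) (re_hermForm_axisVec_pos ht))
      (hypPt (axisVec t') (re_hermForm_axisVec_pos ht')) = |Real.log (t / t')| / 2 := by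
  have h6 : ∀ t : ℝ, RCLike.re (hermForm (k := k) (axisVec t) (axisVec t) : 𝕜) = 2 * t := by
    intro t; rw [hermForm_axisVec]; simp; ring
  rw [hypDist_hypPt, ← Real.arcosh_cosh (x := |Real.log (t / t')| / 2) (by positivity), h6, h6]
  congr 1
  refine (sq_eq_sq₀ (by positivity) (Real.cosh_pos _).le).1 ?_
  rw [cosh_half_log_sq (by positivity), div_pow, Real.sq_sqrt (by positivity),
    norm_hermForm_axisVec_sq]
  simp
  field_simp
  ring

theorem InAxisCone.exists_eq_axisVec {v : Fin (k + 2) → 𝕜} (hc : InAxisCone v)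
    (hv : 0 < RCLike.re (hermForm v v)) :
    ∃ (t : ℝ) (ht : 0 < t), hypPt v hv = hypPt (axisVec t) (re_hermForm_axisVec_pos ht) := by
  obtain ⟨ha, hb⟩ := norm_pos_of_re_hermForm_pos hv
  obtain ⟨h0, h1, h2⟩ := hc
  refine ⟨axisCoord v, by unfold axisCoord; positivity, hypPt_eq _ _ (v (Fin.last (k + 1))) ?_⟩
  have h3 : star (v 0) * v (Fin.last (k + 1)) = ((‖v 0‖ * ‖v (Fin.last (k + 1))‖ : ℝ) : 𝕜) := by
    have h4 : star (v 0) * v (Fin.last (k + 1)) =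
        ((RCLike.re (star (v 0) * v (Fin.last (k + 1))) : ℝ) : 𝕜) := by
      rw [← RCLike.re_add_im (star (v 0) * v (Fin.last (k + 1))), h1]
      simp
    rw [h4]
    congr 1
    have := congrArg norm h4
    rw [norm_mul, norm_star, RCLike.norm_ofReal, abs_of_nonneg h2] at this
    exact this.symm
  ext i
  induction i using blk_forall with
  | h0 =>
    simp only [Pi.smul_apply, axisVec_zero, smul_eq_mul, axisCoord]
    have h5 : v 0 * (star (v 0) * v (Fin.last (k + 1))) =
        ((‖v 0‖ ^ 2 : ℝ) : 𝕜) * v (Fin.last (k + 1)) := by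
      rw [← mul_assoc, RCLike.star_def, RCLike.mul_conj]; simp
    rw [h3] at h5
    have ha' : ((‖v 0‖ : ℝ) : 𝕜) ≠ 0 := by exact_mod_cast ha.ne'
    have hb' : ((‖v (Fin.last (k + 1))‖ : ℝ) : 𝕜) ≠ 0 := by exact_mod_cast hb.ne'
    push_cast at h5 ⊢
    field_simp
    refine mul_left_cancel₀ ha' ?_
    linear_combination -h5
  | hm j =>
    have := congrFun h0 j
    simp only [mid, Pi.zero_apply] at this
    simp [this, axisVec]
  | hl => simp

theorem inAxisCone_axisVec {t : ℝ} (ht : 0 < t) :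
    InAxisCone (axisVec t : Fin (k + 2) → 𝕜) := by
  refine ⟨mid_axisVec t, ?_, ?_⟩ <;> simp [ht.le]

/-- Off the axis, both distances strictly exceed those to the point with parameter `axisCoord v`.
The triangle inequality for logarithms of parameters then contradicts additivity. -/
theorem inAxisCone_of_hypDist_add {t t' : ℝ} (ht : 0 < t) (ht' : 0 < t') {v : Fin (k + 2) → 𝕜}
    (hv : 0 < RCLike.re (hermForm v v))
    (h : hypDist (hypPt (𝕜 := 𝕜) (k := k) (axisVec t) (re_hermForm_axisVec_pos ht)) (hypPt v hv) +
      hypDist (hypPt v hv) (hypPt (axisVec t') (re_hermForm_axisVec_pos ht')) =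
      hypDist (hypPt (𝕜 := 𝕜) (k := k) (axisVec t) (re_hermForm_axisVec_pos ht))
        (hypPt (axisVec t') (re_hermForm_axisVec_pos ht'))) : InAxisCone v := by
  by_contra hc
  obtain ⟨ha, hb⟩ := norm_pos_of_re_hermForm_pos hv
  have h0 : 0 < axisCoord v := by unfold axisCoord; positivity
  have h1 := half_log_lt_hypDist ht hv hc
  have h2 := half_log_lt_hypDist ht' hv hc
  rw [hypDist_axisVec_axisVec ht ht', hypDist_comm (hypPt v hv)] at h
  rw [Real.log_div ht.ne' h0.ne'] at h1
  rw [Real.log_div ht'.ne' h0.ne'] at h2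
  rw [Real.log_div ht.ne' ht'.ne'] at h
  have h3 := abs_sub_le (Real.log t) (Real.log (axisCoord v)) (Real.log t')
  rw [abs_sub_comm (Real.log (axisCoord v))] at h3
  linarith

end AxisMetric

/-! ### Cyclic loxodromic groups are convex-cocompact -/

section ConvexCocompact

variable {𝕜 : Type*} [RCLike 𝕜] {k : ℕ}

variable (𝕜 k) in
/-- The points of the axis from `[1, 0, …, 0]` to `[0, …, 0, 1]`. -/
def axisPt (t : {t : ℝ // 0 < t}) : HypSpace 𝕜 k := hypPt (axisVec t.1) (re_hermForm_axisVec_pos t.2)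

/-- The axis of `h * lev a b A * h⁻¹`. -/
def axisSet (h : SUform 𝕜 k) : Set (HypSpace 𝕜 k) := range fun t => h • axisPt 𝕜 k t

theorem hypPt_mem_axisSet_iff (h : SUform 𝕜 k) {v : Fin (k + 2) → 𝕜}
    (hv : 0 < RCLike.re (hermForm v v)) :
    hypPt v hv ∈ axisSet h ↔ InAxisCone ((h⁻¹).1.1 *ᵥ v) := by
  have hv' : 0 < RCLike.re (hermForm ((h⁻¹).1.1 *ᵥ v) ((h⁻¹).1.1 *ᵥ v)) := by
    rwa [(h⁻¹).2]
  constructor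
  · rintro ⟨t, ht⟩
    have h1 : axisPt 𝕜 k t = hypPt _ hv' := by
      rw [← smul_hypPt h⁻¹ v hv, ← ht, inv_smul_smul]
    obtain ⟨c, hc, hrep⟩ := exists_smul_eq_rep_hypPt _ hv'
    obtain ⟨c', hc', hrep'⟩ := exists_smul_eq_rep_hypPt _
      (re_hermForm_axisVec_pos (𝕜 := 𝕜) (k := k) t.2)
    rw [← inAxisCone_smul_iff hc, ← hrep, ← h1]
    change InAxisCone (hypPt _ _).1.rep
    rw [hrep', inAxisCone_smul_iff hc']
    exact inAxisCone_axisVec t.2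
  · intro hc
    obtain ⟨t, ht, h1⟩ := hc.exists_eq_axisVec hv'
    refine ⟨⟨t, ht⟩, ?_⟩
    change h • hypPt _ _ = _
    rw [← h1, ← smul_hypPt h⁻¹ v hv, smul_inv_smul]

/-- The cone condition is closed and invariant under scaling, so it defines a closed set for the
quotient topology on lines. -/
theorem isClosed_axisSet (h : SUform 𝕜 k) : IsClosed (axisSet h) := by
  let _ : TopologicalSpace (ℙ 𝕜 (Fin (k + 2) → 𝕜)) :=
    TopologicalSpace.coinduced (Projectivization.mk' 𝕜 (V := Fin (k + 2) → 𝕜)) inferInstance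
  refine isClosed_induced_iff.2 ⟨{q | InAxisCone ((h⁻¹).1.1 *ᵥ q.rep)}, ?_, ?_⟩
  · refine isClosed_coinduced.2 ?_
    have h1 : Projectivization.mk' 𝕜 ⁻¹' {q : ℙ 𝕜 (Fin (k + 2) → 𝕜) |
        InAxisCone ((h⁻¹).1.1 *ᵥ q.rep)} = {v | InAxisCone ((h⁻¹).1.1 *ᵥ v.1)} := by
      ext v
      obtain ⟨a, ha⟩ := Projectivization.exists_smul_eq_mk_rep 𝕜 v.1 v.2
      simp only [mem_preimage, mem_ofPred_eq, Projectivization.mk'_eq_mk, ← ha]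
      rw [Units.smul_def, Matrix.mulVec_smul, inAxisCone_smul_iff a.ne_zero]
    rw [h1]
    have h2 : Continuous fun v : {v : Fin (k + 2) → 𝕜 // v ≠ 0} => (h⁻¹).1.1 *ᵥ v.1 :=
      continuous_const.matrix_mulVec continuous_subtype_val
    have h3 : ∀ i, Continuous fun v : {v : Fin (k + 2) → 𝕜 // v ≠ 0} =>
      ((h⁻¹).1.1 *ᵥ v.1) i := fun i => (continuous_apply i).comp h2
    refine IsClosed.inter ?_ (IsClosed.inter ?_ ?_)
    · exact isClosed_eq (continuous_pi fun j => h3 _) continuous_const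
    · exact isClosed_eq (RCLike.continuous_im.comp ((h3 _).star.mul (h3 _))) continuous_const
    · exact isClosed_le continuous_const (RCLike.continuous_re.comp ((h3 _).star.mul (h3 _)))
  · ext p
    conv_rhs => rw [← hypPt_rep p, hypPt_mem_axisSet_iff]
    rfl

theorem hypConvex_axisSet (h : SUform 𝕜 k) : HypConvex (axisSet h) := by
  rintro _ ⟨t, rfl⟩ _ ⟨t', rfl⟩ p hp
  obtain ⟨q, rfl⟩ : ∃ q, p = h • q := ⟨h⁻¹ • p, (smul_inv_smul h p).symm⟩
  simp only [hypDist_smul_smul] at hp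
  rw [← hypPt_rep q, smul_hypPt, hypPt_mem_axisSet_iff, Matrix.mulVec_mulVec, ← SUform.mul_val,
    inv_mul_cancel, SUform.one_val, Matrix.one_mulVec]
  rw [← hypPt_rep q] at hp
  exact inAxisCone_of_hypDist_add t.2 t'.2 q.2 hp

theorem zpow_mulVec {g : SUform 𝕜 k} {v : Fin (k + 2) → 𝕜} {c : 𝕜} (hc : c ≠ 0)
    (h : g.1.1 *ᵥ v = c • v) (m : ℤ) : (g ^ m).1.1 *ᵥ v = c ^ m • v := by
  have h' : (g⁻¹).1.1 *ᵥ v = c⁻¹ • v := by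
    have h1 : (g⁻¹).1.1 *ᵥ (g.1.1 *ᵥ v) = v := by
      rw [Matrix.mulVec_mulVec, ← SUform.mul_val, inv_mul_cancel, SUform.one_val,
        Matrix.one_mulVec]
    rw [h, Matrix.mulVec_smul] at h1
    rw [← h1, smul_smul, inv_mul_cancel₀ hc, one_smul, h1]
  induction m using Int.induction_on with
  | zero => simp
  | succ n ih =>
    rw [zpow_add_one, SUform.mul_val, ← Matrix.mulVec_mulVec, h, Matrix.mulVec_smul, ih,
      smul_smul, zpow_add_one₀ hc, mul_comm]
  | pred n ih =>
    rw [zpow_sub_one, SUform.mul_val, ← Matrix.mulVec_mulVec, h', Matrix.mulVec_smul, ih,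
      smul_smul, zpow_sub_one₀ hc, mul_comm]

theorem lev_mulVec_single (a b : 𝕜) (A : Matrix (Fin k) (Fin k) 𝕜) (hab : star a * b = 1)
    (hA : Aᴴ * A = 1) (hdet : a * (A.det * b) = 1) :
    (lev a b A hab hA hdet).1.1 *ᵥ Pi.single 0 1 = a • Pi.single 0 1 := by
  ext i
  rw [lev, SUform.mk]
  induction i using blk_forall <;> simp

theorem lev_smul_axisPt (a b : 𝕜) (A : Matrix (Fin k) (Fin k) 𝕜) (hab : star a * b = 1)
    (hA : Aᴴ * A = 1) (hdet : a * (A.det * b) = 1) (t : {t : ℝ // 0 < t}) (r : {t : ℝ // 0 < t})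
    (hr : r.1 = ‖a‖ ^ 2) :
    lev a b A hab hA hdet • axisPt 𝕜 k t = axisPt 𝕜 k ⟨r.1 * t.1, mul_pos r.2 t.2⟩ := by
  rw [axisPt, smul_hypPt]
  refine hypPt_eq _ _ b ?_
  rw [lev, SUform.mk]
  have h1 : ((r.1 : ℝ) : 𝕜) * b = a := by
    rw [hr, RCLike.ofReal_pow, ← RCLike.mul_conj, mul_assoc, ← RCLike.star_def, hab, mul_one]
  ext i
  induction i using blk_forall with
  | h0 =>
    rw [blk_mulVec_zero]
    simp [← h1]; ring
  | hm j =>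
    have := congrFun (mid_blk_mulVec a 0 0 A 0 b (axisVec t.1)) j
    simp only [mid_axisVec, Matrix.mulVec_zero, smul_zero, add_zero] at this
    simpa [axisVec] using (show (blk a 0 0 A 0 b *ᵥ axisVec t.1) (midx j) = 0 from this).symm
  | hl =>
    rw [blk_mulVec_last]
    simp

theorem lev_zpow_smul_axisPt (a b : 𝕜) (A : Matrix (Fin k) (Fin k) 𝕜) (hab : star a * b = 1)
    (hA : Aᴴ * A = 1) (hdet : a * (A.det * b) = 1) (r : {t : ℝ // 0 < t})
    (hr : r.1 = ‖a‖ ^ 2) (m : ℤ) (t : {t : ℝ // 0 < t}) :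
    lev a b A hab hA hdet ^ m • axisPt 𝕜 k t =
      axisPt 𝕜 k ⟨r.1 ^ m * t.1, mul_pos (zpow_pos r.2 m) t.2⟩ := by
  have h1 := lev_smul_axisPt a b A hab hA hdet (r := r) (hr := hr)
  have hr0 : r.1 ≠ 0 := r.2.ne'
  have h2 : ∀ t, (lev a b A hab hA hdet)⁻¹ • axisPt 𝕜 k t =
      axisPt 𝕜 k ⟨r.1⁻¹ * t.1, mul_pos (inv_pos.2 r.2) t.2⟩ := by
    intro t
    rw [inv_smul_eq_iff, h1]
    congr 1
    ext
    simp [hr0]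
  induction m using Int.induction_on generalizing t with
  | zero => simp
  | succ n ih =>
    rw [zpow_add_one, mul_smul, h1, ih]
    congr 1
    ext
    simp only [zpow_add_one₀ hr0]
    ring
  | pred n ih =>
    rw [zpow_sub_one, mul_smul, h2, ih]
    congr 1
    ext
    simp only [zpow_sub_one₀ hr0]
    ring

theorem conj_zpow' {G : Type*} [Group G] (h d : G) (m : ℤ) :
    (h * d * h⁻¹) ^ m = h * d ^ m * h⁻¹ := by
  simp [conj_zpow]

/-- The axis serves as the convex set. The generator multiplies its parameter by `‖a‖ ^ 2`, so the
parameters in `[1, ‖a‖ ^ 2]` give a compact set whose translates cover it. -/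
theorem isConvexCocompact_zpowersHom_conj_lev (h : SUform 𝕜 k) (a b : 𝕜)
    (A : Matrix (Fin k) (Fin k) 𝕜) (hab : star a * b = 1)
    (hA : Aᴴ * A = 1) (hdet : a * (A.det * b) = 1) (ha : 1 < ‖a‖) :
    IsConvexCocompact 𝕜 k (zpowersHom (SUform 𝕜 k) (h * lev a b A hab hA hdet * h⁻¹)) := by
  set D := lev a b A hab hA hdet with hD
  have ha0 : a ≠ 0 := norm_pos_iff.1 (by linarith)
  -- After undoing the conjugation, the corner entry of the `m`-th power is `a ^ m`. Its norm is a
  -- continuous function that separates the powers, which settles both kernel and discreteness.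
  let f : SUform 𝕜 k → ℝ := fun g => ‖(h⁻¹ * g * h).1.1 0 0‖
  have hf : Continuous f :=
    ((SUform.continuous_apply 0 0).comp ((continuous_const.mul continuous_id).mul
      continuous_const)).norm
  have hfm : ∀ m : ℤ, f ((h * D * h⁻¹) ^ m) = ‖a‖ ^ m := by
    intro m
    have h1 : h⁻¹ * (h * D * h⁻¹) ^ m * h = D ^ m := by rw [conj_zpow']; group
    have h2 := congrFun (zpow_mulVec ha0 (lev_mulVec_single a b A hab hA hdet) m) 0
    simp only [Matrix.mulVec_single_one, Matrix.col_apply, Pi.smul_apply, Pi.single_eq_same,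
      smul_eq_mul, mul_one] at h2
    simp only [f, h1]
    rw [hD, h2, norm_zpow]
  have hinj : ∀ m : ℤ, ‖a‖ ^ m < ‖a‖ → ‖a‖⁻¹ < ‖a‖ ^ m → m = 0 := by
    intro m h1 h2
    rw [← zpow_one ‖a‖, ← zpow_mul, one_mul, zpow_lt_zpow_iff_right₀ ha] at h1
    rw [← zpow_neg_one, zpow_lt_zpow_iff_right₀ ha] at h2
    omega
  have hlt : ‖a‖⁻¹ < 1 := inv_lt_one_of_one_lt₀ ha
  refine ⟨?_, ?_, axisSet h, ⟨_, ⟨⟨1, one_pos⟩, rfl⟩⟩, isClosed_axisSet h, hypConvex_axisSet h,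
    ?_, ?_⟩
  · have : (zpowersHom (SUform 𝕜 k) (h * D * h⁻¹)).ker = ⊥ := by
      refine (Subgroup.eq_bot_iff_forall _).2 fun m hm => ?_
      have h1 : (h * D * h⁻¹) ^ m.toAdd = 1 := hm
      have h2 := hfm m.toAdd
      have h3 := hfm 0
      rw [h1] at h2
      rw [zpow_zero, h2, zpow_zero] at h3
      exact Multiplicative.toAdd.injective (hinj _ (by rwa [h3]) (by rwa [h3]))
    rw [this]
    infer_instance
  · refine discreteTopology_of_isOpen_singleton_one ?_
    have h2 : IsOpen {x : (zpowersHom (SUform 𝕜 k) (h * D * h⁻¹)).range |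
        f x.1 ∈ Ioo ‖a‖⁻¹ ‖a‖} := isOpen_Ioo.preimage (hf.comp continuous_subtype_val)
    convert h2 using 1
    ext ⟨x, m, rfl⟩
    simp only [mem_singleton_iff, mem_ofPred_eq, zpowersHom_apply, hfm]
    constructor
    · intro h3
      have h4 : (h * D * h⁻¹) ^ m.toAdd = 1 := congrArg Subtype.val h3
      have h5 := hfm m.toAdd
      have h6 := hfm 0
      rw [h4] at h5
      rw [zpow_zero, h5, zpow_zero] at h6
      rw [h6]
      exact ⟨hlt, ha⟩
    · intro h3
      have := hinj _ h3.2 h3.1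
      refine Subtype.ext ?_
      simp [this]
  · rintro m _ ⟨t, rfl⟩
    refine ⟨_, (?_ : h • axisPt 𝕜 k ⟨(‖a‖ ^ 2) ^ m.toAdd * t.1,
      mul_pos (by positivity) t.2⟩ = _)⟩
    rw [zpowersHom_apply, conj_zpow', ← mul_smul, inv_mul_cancel_right, mul_smul, hD,
      lev_zpow_smul_axisPt a b A hab hA hdet ⟨‖a‖ ^ 2, by positivity⟩ rfl]
  · have ha2 : 1 < ‖a‖ ^ 2 := one_lt_pow₀ ha two_ne_zero
    let e : Icc (1 : ℝ) (‖a‖ ^ 2) → {t : ℝ // 0 < t} := fun t => ⟨t.1, one_pos.trans_le t.2.1⟩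
    have he : Continuous e := continuous_subtype_val.subtype_mk _
    refine ⟨range fun t => h • axisPt 𝕜 k (e t), ?_, ?_, ?_⟩
    · refine isCompact_range ?_
      have : Continuous fun t : {t : ℝ // 0 < t} => h • axisPt 𝕜 k t := by
        refine continuous_hypPt (f := fun t : {t : ℝ // 0 < t} => h.1.1 *ᵥ axisVec t.1) ?_
          fun t => by rw [h.2]; exact re_hermForm_axisVec_pos t.2
        refine continuous_const.matrix_mulVec (continuous_pi fun i => ?_)
        unfold axisVec
        split_ifs <;> fun_prop
      exact this.comp he
    · rintro _ ⟨t, rfl⟩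
      exact ⟨e t, rfl⟩
    · rintro _ ⟨t, rfl⟩
      obtain ⟨m, hm1, hm2⟩ := exists_mem_Ico_zpow t.2 ha2
      have hpos : 0 < (‖a‖ ^ 2) ^ m := by positivity
      refine ⟨.ofAdd m, _, ⟨⟨t.1 / (‖a‖ ^ 2) ^ m, ?_, ?_⟩, rfl⟩, ?_⟩
      · rwa [le_div_iff₀ hpos, one_mul]
      · rw [div_le_iff₀ hpos]
        rw [zpow_add_one₀ (by positivity)] at hm2
        linarith
      · rw [zpowersHom_apply, conj_zpow', ← mul_smul, toAdd_ofAdd, inv_mul_cancel_right, mul_smul,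
          hD, lev_zpow_smul_axisPt a b A hab hA hdet ⟨‖a‖ ^ 2, by positivity⟩ rfl]
        simp only [e]
        congr 2
        ext
        simp only
        field_simp

/-- A subgroup acts by restriction, so the same convex and compact sets work; its range embeds
continuously into the discrete range in the big group. -/
theorem IsConvexCocompact.of_subtype_comp {Γ : Type*} [Group Γ] {H : Subgroup (SUform 𝕜 k)}
    {ρ : Γ →* H} (h : IsConvexCocompact 𝕜 k (H.subtype.comp ρ)) : IsConvexCocompact 𝕜 k ρ := by
  obtain ⟨h1, h2, C, hC, hCc, hconv, hinv, K, hK, hKC, hcov⟩ := h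
  refine ⟨?_, ?_, C, hC, hCc, hconv, hinv, K, hK, hKC, hcov⟩
  · have : (H.subtype.comp ρ).ker = ρ.ker := by
      ext; simp [MonoidHom.mem_ker]
    rwa [this] at h1
  · have hm : ∀ x : ρ.range, (x.1 : SUform 𝕜 k) ∈ (H.subtype.comp ρ).range := by
      rintro ⟨_, γ, rfl⟩
      exact ⟨γ, rfl⟩
    refine DiscreteTopology.of_continuous_injective
      (f := fun x : ρ.range => (⟨x.1.1, hm x⟩ : (H.subtype.comp ρ).range)) (by fun_prop) ?_
    intro x y hxy
    have := congrArg Subtype.val hxy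
    exact Subtype.ext (Subtype.ext this)

end ConvexCocompact

/-! ### Digits along a divisibility chain -/

section Digits

/-- An integer that is close to multiples of the members of a divisibility chain is a combination
of these members with small coefficients. -/
theorem exists_digits (l : ℕ) (E : ℕ → ℕ) (hE0 : E 0 = 1) (hE : ∀ i, E i ∣ E (i + 1))
    (hpos : ∀ i, 0 < E i) {C : ℝ} (hC : 0 ≤ C) (m : ℤ) (hm : |(m : ℝ)| ≤ C * E l)
    (hb : ∀ i < l, ∃ b : ℤ, |(m : ℝ) - b * E (i + 1)| ≤ C * E i) :
    ∃ a : Fin (l + 1) → ℤ, (∀ i, |(a i : ℝ)| ≤ 2 * C) ∧ m = ∑ i, a i * E i := by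
  choose q hq using hE
  choose! b hb using hb
  -- The boundary values fit the pattern: `m` is an exact multiple of `E 0 = 1`, and the bound on
  -- `|m|` says that `0` approximates it at level `l + 1`.
  let b' : ℕ → ℤ := fun i => if i = 0 then m else if i ≤ l then b (i - 1) else 0
  have hb0 : b' 0 = m := by simp [b']
  have hbl : b' (l + 1) = 0 := by simp [b']
  have hbE : ∀ i ≤ l, |(m : ℝ) - b' i * E i| ≤ C * E i := by
    intro i hi
    cases i with
    | zero => simp [hb0, hE0, hC]
    | succ i =>
      have h1 : b' (i + 1) = b i := by simp [b', hi]
      rw [h1]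
      refine (hb i hi).trans ?_
      gcongr
      exact Nat.le_of_dvd (hpos _) ⟨q i, hq i⟩
  have hbE' : ∀ i ≤ l, |(m : ℝ) - b' (i + 1) * E (i + 1)| ≤ C * E i := by
    intro i hi
    rcases hi.eq_or_lt with rfl | hi
    · simpa [hbl] using hm
    · have h1 : b' (i + 1) = b i := by simp [b', Nat.succ_le_of_lt hi]
      rw [h1]
      exact hb i hi
  -- Times `E i`, this digit is the difference of consecutive approximations to `m`. That bounds it
  -- by `2 * C` and makes the sum telescope.
  refine ⟨fun i => b' i - q i * b' (i + 1), fun i => ?_, ?_⟩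
  · have h1 := hbE i (Nat.le_of_lt_succ i.2)
    have h2 := hbE' i (Nat.le_of_lt_succ i.2)
    have h3 : (0 : ℝ) < E i := by exact_mod_cast hpos i
    refine le_of_mul_le_mul_right ?_ h3
    have h4 : ((b' i - q i * b' (i + 1) : ℤ) : ℝ) * E i =
        ((m : ℝ) - b' (i + 1) * E (i + 1)) - ((m : ℝ) - b' i * E i) := by
      rw [hq]; push_cast; ring
    rw [← abs_of_pos h3, ← abs_mul, h4, abs_of_pos h3]
    refine (abs_sub _ _).trans ?_
    linarith
  · rw [Fin.sum_univ_eq_sum_range (fun i => (b' i - q i * b' (i + 1)) * (E i : ℤ)) (l + 1)]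
    have h1 : ∀ i, (b' i - q i * b' (i + 1)) * (E i : ℤ) = b' i * E i - b' (i + 1) * E (i + 1) := by
      intro i; rw [hq]; push_cast; ring
    simp only [h1]
    rw [Finset.sum_range_sub' (fun i => b' i * (E i : ℤ)), hbl, hb0, hE0]
    simp

end Digits

/-! ### Small rotations and dilations: bounds and asymptotics -/

section Estimates

open Complex

/-- The rotation by `x` full turns. -/
noncomputable def turn (x : ℝ) : ℂ := exp (2 * Real.pi * x * I)

theorem turn_add (x y : ℝ) : turn (x + y) = turn x * turn y := by
  rw [turn, turn, turn, ← exp_add]; push_cast; ring_nf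

theorem turn_int (m : ℤ) : turn m = 1 :=
  exp_eq_one_iff.2 ⟨m, by push_cast; ring⟩

theorem turn_zero : turn 0 = 1 := by simp [turn]

theorem turn_eq_of_sub_eq_int {x y : ℝ} {m : ℤ} (h : x - y = m) : turn x = turn y := by
  rw [show x = m + y by linarith, turn_add, turn_int, one_mul]

theorem norm_turn (x : ℝ) : ‖turn x‖ = 1 := by
  rw [turn, show (2 * Real.pi * x * I : ℂ) = ((2 * Real.pi * x : ℝ) : ℂ) * I by push_cast; ring,
    norm_exp_ofReal_mul_I]

theorem turn_neg (x : ℝ) : turn (-x) = star (turn x) := by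
  rw [turn, turn, star_def, ← exp_conj]
  simp [map_ofNat]

theorem continuous_turn : Continuous turn := by
  unfold turn; fun_prop

theorem im_turn (x : ℝ) : (turn x).im = Real.sin (2 * Real.pi * x) := by
  rw [turn, show (2 * Real.pi * x * I : ℂ) = ((2 * Real.pi * x : ℝ) : ℂ) * I by push_cast; ring,
    exp_ofReal_mul_I_im]

/-- The chord has length `2 |sin (π δ)|` for the offset `δ` from the nearest integer, and Jordan's
inequality applies as `|δ| ≤ 1/2`. -/
theorem exists_int_abs_sub_le_norm_turn_sub_one (x : ℝ) : ∃ b : ℤ, 4 * |x - b| ≤ ‖turn x - 1‖ := by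
  refine ⟨round x, ?_⟩
  set δ := x - round x with hδ
  have h1 : |δ| ≤ 1 / 2 := abs_sub_round x
  have h2 : turn x = turn δ := turn_eq_of_sub_eq_int (m := round x) (by rw [hδ]; ring)
  have h3 : ‖turn δ - 1‖ = 2 * |Real.sin (Real.pi * δ)| := by
    rw [turn, show (2 * Real.pi * δ * I : ℂ) = I * ((2 * Real.pi * δ : ℝ) : ℂ) by push_cast; ring,
      norm_exp_I_mul_ofReal_sub_one, norm_mul]
    simp only [Real.norm_eq_abs, Nat.abs_ofNat]
    ring_nf
  rw [h2, h3]
  have h4 : |Real.sin (Real.pi * δ)| = Real.sin (Real.pi * |δ|) := by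
    rcases abs_cases δ with ⟨h, h'⟩ | ⟨h, h'⟩
    · rw [h, abs_of_nonneg (Real.sin_nonneg_of_nonneg_of_le_pi (by positivity) ?_)]
      nlinarith [Real.pi_pos]
    · rw [h, mul_neg, Real.sin_neg, abs_of_nonpos]
      rw [← neg_nonneg, ← Real.sin_neg]
      exact Real.sin_nonneg_of_nonneg_of_le_pi (by nlinarith [Real.pi_pos])
        (by nlinarith [Real.pi_pos])
  have h5 := Real.mul_le_sin (x := Real.pi * |δ|) (by positivity) (by nlinarith [Real.pi_pos])
  rw [h4]
  have h6 : 2 / Real.pi * (Real.pi * |δ|) = 2 * |δ| := by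
    field_simp
  linarith

/-- Since `turn x` has modulus one, comparing moduli controls the dilation; removing it then
controls the rotation. -/
theorem abs_le_and_exists_int_of_norm_sub_turn_le {Q R σ x : ℝ} (hQ : 0 < Q) (hR : 2 * R ≤ Q)
    (h : Q * ‖((Real.exp (-σ) : ℝ) : ℂ) - turn x‖ ≤ R) :
    |σ| ≤ 2 * R / Q ∧ ∃ b : ℤ, |x - b| ≤ R / Q := by
  have hle : ‖((Real.exp (-σ) : ℝ) : ℂ) - turn x‖ ≤ R / Q := by
    rwa [le_div_iff₀ hQ, mul_comm]
  have hh : R / Q ≤ 1 / 2 := by rw [div_le_iff₀ hQ]; linarith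
  have hh0 : 0 ≤ R / Q := (norm_nonneg _).trans hle
  have h1 : |Real.exp (-σ) - 1| ≤ R / Q := by
    have h2 := abs_norm_sub_norm_le ((Real.exp (-σ) : ℝ) : ℂ) (turn x)
    rw [norm_turn, norm_real, Real.norm_eq_abs, Real.abs_exp] at h2
    exact h2.trans hle
  obtain ⟨h3, h4⟩ := abs_le.1 h1
  rw [mul_div_assoc]
  constructor
  · rw [abs_le]
    constructor
    · have h5 := Real.add_one_le_exp (-σ)
      linarith
    -- With `h = R / Q ≤ 1/2` and `σ > 2h`, the product `(1 - h) * (1 + σ)` would exceed `(1 - h) *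
    -- (1 + 2h) ≥ 1`, yet it is at most `exp (-σ) * exp σ = 1`.
    · by_contra! h5
      have h7 : Real.exp (-σ) * Real.exp σ = 1 := by rw [← Real.exp_add]; simp
      have h8 := Real.add_one_le_exp σ
      have h9 := mul_le_mul (show 1 - R / Q ≤ Real.exp (-σ) by linarith) h8 (by linarith)
        (Real.exp_pos _).le
      nlinarith
  · obtain ⟨b, hb⟩ := exists_int_abs_sub_le_norm_turn_sub_one x
    refine ⟨b, ?_⟩
    have h5 : ‖turn x - 1‖ ≤ ‖((Real.exp (-σ) : ℝ) : ℂ) - turn x‖ + |Real.exp (-σ) - 1| := by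
      rw [show turn x - 1 = -((Real.exp (-σ) : ℝ) - turn x) + ((Real.exp (-σ) - 1 : ℝ) : ℂ) by
        push_cast; ring]
      refine (norm_add_le _ _).trans ?_
      rw [norm_neg, norm_real, Real.norm_eq_abs]
    have := abs_nonneg (x - b)
    linarith

variable {Q : ℕ → ℝ} {f : Filter ℕ}

theorem tendsto_zero_of_mul_tendsto {𝕜 : Type*} [RCLike 𝕜] {Q : ℕ → ℝ} {f : Filter ℕ}
    (hQ : Tendsto Q f atTop) {z : ℕ → 𝕜} {w : 𝕜}
    (hz : Tendsto (fun n => (Q n : 𝕜) * z n) f (𝓝 w)) : Tendsto z f (𝓝 0) := by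
  have h1 : Tendsto (fun n => (((Q n)⁻¹ : ℝ) : 𝕜)) f (𝓝 0) := by
    have := ((RCLike.continuous_ofReal (K := 𝕜)).tendsto 0).comp
      (tendsto_inv_atTop_zero.comp hQ)
    rwa [RCLike.ofReal_zero] at this
  have h2 := h1.mul hz
  rw [zero_mul] at h2
  refine h2.congr' ?_
  filter_upwards [hQ.eventually_gt_atTop 0] with n hn
  have : ((Q n : ℝ) : 𝕜) ≠ 0 := by exact_mod_cast hn.ne'
  push_cast
  field_simp

/-- Second-order Taylor expansion: `Q * z` converges, so `Q ^ 2` times the cubic remainder tends to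
zero. -/
theorem tendsto_sq_mul_exp_sub (hQ : Tendsto Q f atTop) {z : ℕ → ℂ} {w : ℂ}
    (hz : Tendsto (fun n => (Q n : ℂ) * z n) f (𝓝 w)) :
    Tendsto (fun n => (Q n : ℂ) ^ 2 * (exp (z n) - 1 - z n)) f (𝓝 (w ^ 2 / 2)) := by
  have hz0 := tendsto_zero_of_mul_tendsto hQ hz
  have h1 : Tendsto (fun n => (Q n : ℂ) ^ 2 * (exp (z n) - 1 - z n - z n ^ 2 / 2)) f (𝓝 0) := by
    rw [tendsto_zero_iff_norm_tendsto_zero]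
    have h2 : Tendsto (fun n => ‖(Q n : ℂ) * z n‖ ^ 2 * ‖z n‖) f (𝓝 0) := by
      simpa using (hz.norm.pow 2).mul hz0.norm
    refine squeeze_zero' (.of_forall fun n => norm_nonneg _) ?_ h2
    have h3 : ∀ᶠ n in f, ‖z n‖ < 1 := by
      have := hz0.norm.eventually_lt_const (u := 1) (by simp)
      exact this
    filter_upwards [h3] with n hn
    have h4 := exp_bound hn.le (n := 3) (by norm_num)
    simp only [Finset.sum_range_succ, Finset.sum_range_zero, Nat.factorial] at h4
    norm_num at h4
    rw [norm_mul, norm_pow, norm_mul]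
    have h5 : ‖exp (z n) - 1 - z n - z n ^ 2 / 2‖ ≤ ‖z n‖ ^ 3 := by
      rw [show exp (z n) - 1 - z n - z n ^ 2 / 2 = exp (z n) - (1 + z n + z n ^ 2 / 2) by ring]
      refine h4.trans ?_
      have : 0 ≤ ‖z n‖ ^ 3 := by positivity
      linarith
    calc _ ≤ ‖(Q n : ℂ)‖ ^ 2 * ‖z n‖ ^ 3 := by gcongr
      _ = _ := by ring
  have h2 := h1.add ((hz.pow 2).div_const 2)
  rw [zero_add] at h2
  refine h2.congr fun n => ?_
  ring

theorem tendsto_mul_exp_sub_one (hQ : Tendsto Q f atTop) {z : ℕ → ℂ} {w : ℂ}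
    (hz : Tendsto (fun n => (Q n : ℂ) * z n) f (𝓝 w)) :
    Tendsto (fun n => (Q n : ℂ) * (exp (z n) - 1)) f (𝓝 w) := by
  have h1 : Tendsto (fun n => (Q n : ℂ) * (exp (z n) - 1 - z n)) f (𝓝 0) := by
    refine tendsto_zero_of_mul_tendsto hQ (w := w ^ 2 / 2) ?_
    refine (tendsto_sq_mul_exp_sub hQ hz).congr fun n => ?_
    simp; ring
  have h2 := h1.add hz
  rw [zero_add] at h2
  refine h2.congr fun n => ?_
  ring

theorem tendsto_ofReal_mul {u v : ℕ → ℝ} {c : ℝ} (h : Tendsto (fun n => u n * v n) f (𝓝 c)) :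
    Tendsto (fun n => (u n : ℂ) * (v n : ℂ)) f (𝓝 c) := by
  refine ((continuous_ofReal.tendsto c).comp h).congr fun n => ?_
  simp

theorem tendsto_mul_two_pi_I {x : ℕ → ℝ} {ξ : ℝ} (hx : Tendsto (fun n => Q n * x n) f (𝓝 ξ)) :
    Tendsto (fun n => (Q n : ℂ) * (2 * Real.pi * x n * I)) f (𝓝 (2 * Real.pi * ξ * I)) := by
  refine (((tendsto_ofReal_mul hx).const_mul (2 * Real.pi : ℂ)).mul_const I).congr fun n => ?_
  ring

/-- First-order expansion of the translation part of a conjugated power. -/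
theorem tendsto_displacement (hQ : Tendsto Q f atTop) {σ x : ℕ → ℝ} {η ξ : ℝ}
    (hσ : Tendsto (fun n => Q n * σ n) f (𝓝 η)) (hx : Tendsto (fun n => Q n * x n) f (𝓝 ξ)) :
    Tendsto (fun n => (Q n : ℂ) * (((Real.exp (-σ n) : ℝ) : ℂ) - turn (x n))) f
      (𝓝 (-(η + 2 * Real.pi * ξ * I))) := by
  have h1 := tendsto_mul_exp_sub_one hQ (tendsto_mul_two_pi_I hx)
  have h2 : Tendsto (fun n => (Q n : ℂ) * ((-σ n : ℝ) : ℂ)) f (𝓝 ((-η : ℝ) : ℂ)) := by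
    refine tendsto_ofReal_mul ?_
    simpa using hσ.neg
  have h3 := tendsto_mul_exp_sub_one hQ h2
  rw [show (-(η + 2 * Real.pi * ξ * I) : ℂ) = ((-η : ℝ) : ℂ) - 2 * Real.pi * ξ * I by
    push_cast; ring]
  refine (h3.sub h1).congr fun n => ?_
  rw [turn]
  push_cast
  ring

/-- The linear term of `turn` is removed because `Q ^ 2 * x` need not converge; `cosh` has no linear
term. What remains is half the squared length of the limit displacement. -/
theorem tendsto_height (hQ : Tendsto Q f atTop) {σ x : ℕ → ℝ} {η ξ : ℝ}
    (hσ : Tendsto (fun n => Q n * σ n) f (𝓝 η)) (hx : Tendsto (fun n => Q n * x n) f (𝓝 ξ)) :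
    Tendsto (fun n => (Q n : ℂ) ^ 2 * (((Real.cosh (σ n) : ℝ) : ℂ) - turn (x n) +
      2 * Real.pi * x n * I)) f (𝓝 (((η : ℂ) ^ 2 + (2 * Real.pi * ξ) ^ 2) / 2)) := by
  have h1 := tendsto_sq_mul_exp_sub hQ (tendsto_mul_two_pi_I hx)
  have h2 : Tendsto (fun n => (Q n : ℂ) * ((-σ n : ℝ) : ℂ)) f (𝓝 ((-η : ℝ) : ℂ)) := by
    refine tendsto_ofReal_mul ?_
    simpa using hσ.neg
  have h3 := tendsto_sq_mul_exp_sub hQ h2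
  have h4 := tendsto_sq_mul_exp_sub hQ (tendsto_ofReal_mul hσ)
  have h5 := ((h3.add h4).div_const 2).sub h1
  have h6 : ((((-η : ℝ) : ℂ) ^ 2 / 2 + (η : ℂ) ^ 2 / 2) / 2 - (2 * Real.pi * ξ * I) ^ 2 / 2 : ℂ) =
      (η ^ 2 + (2 * Real.pi * ξ) ^ 2) / 2 := by
    rw [mul_pow _ I, I_sq]; push_cast; ring
  rw [h6] at h5
  refine h5.congr fun n => ?_
  rw [turn, Real.cosh_eq]
  push_cast
  ring

/-- The distance of `Q ^ a / Q ^ b` to the integer below. -/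
noncomputable def powFrac (Q : ℕ) (a b : ℕ) : ℝ := if b ≤ a then 0 else (Q : ℝ) ^ a / (Q : ℝ) ^ b

theorem exists_int_pow_div_sub_powFrac {Q : ℕ} (hQ : 0 < Q) (a b : ℕ) :
    ∃ m : ℤ, (Q : ℝ) ^ a / (Q : ℝ) ^ b - powFrac Q a b = m := by
  unfold powFrac
  split_ifs with h
  · refine ⟨(Q : ℤ) ^ (a - b), ?_⟩
    have : (Q : ℝ) ≠ 0 := by positivity
    push_cast
    rw [pow_sub₀ _ this h, sub_zero]
    rfl
  · exact ⟨0, by simp⟩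

/-- Separation of scales: whole turns leave no remainder, and among the proper fractions only `1 /
Q` survives multiplication by `Q`. -/
theorem tendsto_mul_powFrac {Q : ℕ → ℕ} (hQ : Tendsto (fun n => (Q n : ℝ)) f atTop) (a b : ℕ) :
    Tendsto (fun n => (Q n : ℝ) * powFrac (Q n) a b) f (𝓝 (if a + 1 = b then 1 else 0)) := by
  unfold powFrac
  rcases lt_trichotomy b (a + 1) with h | rfl | h
  · have h1 : b ≤ a := by omega
    have h2 : a + 1 ≠ b := by omega
    simp [h1, h2, tendsto_const_nhds]
  · simp only [show ¬ (a + 1 ≤ a) by omega, if_false, if_true]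
    refine tendsto_const_nhds.congr' ?_
    filter_upwards [hQ.eventually_gt_atTop 0] with n hn
    field_simp
    ring
  · have h1 : ¬ b ≤ a := by omega
    have h2 : a + 1 ≠ b := by omega
    simp only [h1, h2, if_false]
    have h3 : Tendsto (fun n => ((Q n : ℝ)⁻¹) ^ (b - (a + 1))) f (𝓝 0) := by
      have := (tendsto_inv_atTop_zero.comp hQ).pow (b - (a + 1))
      rwa [zero_pow (by omega)] at this
    refine h3.congr' ?_
    filter_upwards [hQ.eventually_gt_atTop 0] with n hn
    have h4 : (Q n : ℝ) ^ b = (Q n : ℝ) ^ (b - (a + 1)) * (Q n : ℝ) ^ (a + 1) := by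
      rw [← pow_add]; congr 1; omega
    rw [h4, inv_pow]
    field_simp
    ring

end Estimates

/-! ### Diagonal flows and the centre of `SU(1, k+1)` -/

section Complex

variable {k : ℕ}

theorem zpow_eq_of_map_add {G : Type*} [Group G] {f : ℝ → G} (hf : ∀ x y, f (x + y) = f x * f y)
    (m : ℤ) : f 1 ^ m = f m := by
  have h := map_zpow (MonoidHom.mk' (fun x : Multiplicative ℝ => f x.toAdd) fun x y => hf _ _)
    (.ofAdd 1) m
  simp only [MonoidHom.mk'_apply, toAdd_zpow, toAdd_ofAdd, zsmul_eq_mul, mul_one] at h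
  exact h.symm

/-- The diagonal one-parameter groups of `SU(1, k+1)`, with dilation rate `s`, rotation numbers
`y` relative to the rotation number `ω` of the extreme coordinates. -/
noncomputable def diagFlow (ω s : ℝ) (y : Fin k → ℝ) (h : (k + 2) * ω + ∑ j, y j = 0) (x : ℝ) :
    SUform ℂ k :=
  lev (turn (ω * x) * (Real.exp (s * x) : ℝ)) (turn (ω * x) * (Real.exp (-(s * x)) : ℝ))
    (Matrix.diagonal fun j => turn (ω * x) * turn (y j * x))
    (by
      rw [star_mul', ← turn_neg, show star ((Real.exp (s * x) : ℝ) : ℂ) = (Real.exp (s * x) : ℝ) from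
        Complex.conj_ofReal _, mul_mul_mul_comm, ← turn_add, ← Complex.ofReal_mul, ← Real.exp_add]
      simp [turn_zero])
    (by
      rw [Matrix.diagonal_conjTranspose, Matrix.diagonal_mul_diagonal, ← Matrix.diagonal_one]
      congr 1
      ext j
      rw [Pi.star_apply, star_mul', ← turn_neg, ← turn_neg, mul_mul_mul_comm, ← turn_add,
        ← turn_add]
      simp [turn_zero])
    (by
      have hprod : ∀ (c : Fin k → ℝ), ∏ j, turn (c j) = turn (∑ j, c j) := by
        intro c
        have : ∀ S : Finset (Fin k), ∏ j ∈ S, turn (c j) = turn (∑ j ∈ S, c j) := by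
          intro S
          induction S using Finset.induction_on with
          | empty => simp [turn_zero]
          | insert a S ha ih => rw [Finset.prod_insert ha, Finset.sum_insert ha, turn_add, ih]
        exact this _
      simp only [← turn_add]
      rw [Matrix.det_diagonal, hprod]
      have h1 : ((Real.exp (s * x) : ℝ) : ℂ) * (Real.exp (-(s * x)) : ℝ) = 1 := by
        rw [← Complex.ofReal_mul, ← Real.exp_add]; simp
      have h2 : turn (ω * x) * (turn (∑ j, (ω * x + y j * x)) * turn (ω * x)) = 1 := by
        have h3 : ∑ j, (ω * x + y j * x) = (k * ω + ∑ j, y j) * x := by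
          simp only [← add_mul, ← Finset.sum_mul, Finset.sum_add_distrib, Finset.sum_const,
            Finset.card_univ, Fintype.card_fin, nsmul_eq_mul]
        rw [← turn_add, ← turn_add, h3, show ω * x + ((k * ω + ∑ j, y j) * x + ω * x) =
          ((k + 2) * ω + ∑ j, y j) * x by ring, h, zero_mul, turn_zero]
      calc _ = (turn (ω * x) * (turn (∑ j, (ω * x + y j * x)) * turn (ω * x))) *
          (((Real.exp (s * x) : ℝ) : ℂ) * (Real.exp (-(s * x)) : ℝ)) := by ring
        _ = 1 := by rw [h1, h2, one_mul])

theorem diagFlow_add (ω s : ℝ) (y : Fin k → ℝ) (h : (k + 2) * ω + ∑ j, y j = 0) (x x' : ℝ) :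
    diagFlow ω s y h (x + x') = diagFlow ω s y h x * diagFlow ω s y h x' := by
  refine SUform.ext ?_
  rw [SUform.mul_val]
  simp only [diagFlow, lev, SUform.mk, blk_mul, Matrix.diagonal_mul_diagonal]
  congr 1
  · rw [mul_add, mul_add, turn_add, Real.exp_add]; push_cast; ring
  · simp
  · simp
  · congr 1
    ext j
    rw [mul_add, mul_add, turn_add, turn_add]; ring
  · simp
  · rw [mul_add, mul_add, turn_add, neg_add, Real.exp_add]; push_cast; ring

theorem star_turn_mul_self (x : ℝ) : star (turn x) * turn x = 1 := by
  rw [← turn_neg, ← turn_add, neg_add_cancel, turn_zero]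

theorem turn_natCast_mul (n : ℕ) (x : ℝ) : turn (n * x) = turn x ^ n := by
  induction n with
  | zero => simp [turn_zero]
  | succ n ih => rw [pow_succ, ← ih, ← turn_add]; push_cast; ring_nf

/-- The elements of the centre of `SU(1, k+1)`. -/
noncomputable def cen (k : ℕ) (m : ℤ) : SUform ℂ k :=
  lev (turn (-m / (k + 2))) (turn (-m / (k + 2))) (turn (-m / (k + 2)) • 1)
    (star_turn_mul_self _)
    (by simp only [Matrix.conjTranspose_smul, Matrix.conjTranspose_one, Matrix.mul_smul, mul_one, smul_smul, mul_comm (turn _), star_turn_mul_self, one_smul])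
    (by
      rw [Matrix.det_smul, Matrix.det_one, mul_one, Fintype.card_fin]
      have h := turn_natCast_mul (k + 2) (-m / (k + 2))
      rw [show ((k + 2 : ℕ) : ℝ) * (-m / (k + 2)) = ((-m : ℤ) : ℝ) by push_cast; field_simp,
        turn_int] at h
      rw [h]; ring)

theorem cen_val (m : ℤ) : (cen k m).1.1 =
    blk (turn (-m / (k + 2))) 0 0 (turn (-m / (k + 2)) • 1) 0 (turn (-m / (k + 2))) := rfl

theorem cen_mul_hor_val (m : ℤ) (τ : Fin k → ℂ) (t : ℝ) : (cen k m * hor τ t).1.1 =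
    blk (turn (-m / (k + 2))) (turn (-m / (k + 2)) • star τ) (turn (-m / (k + 2)) * horHeight τ t)
      (turn (-m / (k + 2)) • 1) (turn (-m / (k + 2)) • τ) (turn (-m / (k + 2))) := by
  rw [SUform.mul_val, cen_val, hor_val, blk_mul]
  simp [Matrix.smul_mulVec]

theorem cen_mul_hor_mul (m m' : ℤ) {τ τ' : Fin k → ℂ} (t t' : ℝ)
    (h : star τ ⬝ᵥ τ' = star τ' ⬝ᵥ τ) :
    cen k m * hor τ t * (cen k m' * hor τ' t') =
      cen k (m + m') * hor (τ + τ') (t + t') := by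
  have hcen : cen k (m + m') = cen k m * cen k m' := by
    refine SUform.ext ?_
    rw [SUform.mul_val]
    simp only [cen_val, blk_mul]
    have : turn (-((m + m' : ℤ) : ℝ) / (k + 2)) =
        turn (-m / (k + 2)) * turn (-m' / (k + 2)) := by
      rw [← turn_add]; push_cast; ring_nf
    rw [this]
    congr 1 <;> simp [smul_smul, mul_comm]
  have hcomm : hor τ t * cen k m' = cen k m' * hor τ t := by
    refine SUform.ext ?_
    rw [cen_mul_hor_val, SUform.mul_val, cen_val, hor_val, blk_mul]
    congr 1 <;> simp [mul_comm, Matrix.vecMul_smul]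
  rw [hcen, ← hor_mul _ _ _ _ h, mul_assoc, ← mul_assoc (hor τ t), hcomm]
  simp only [mul_assoc]

/-- The displacement of the powers of `hor p 0 * diagFlow * (hor p 0)⁻¹`, where the coordinates of
`p` are `Q` or `0`. -/
theorem hor_mul_diagFlow_mul_inv_val (ω s : ℝ) (y : Fin k → ℝ)
    (h : (k + 2) * ω + ∑ j, y j = 0) (x : ℝ) (l : ℕ) (Q : ℝ) :
    (hor (fun j : Fin k => if (j : ℕ) < l then (Q : ℂ) else 0) 0 * diagFlow ω s y h x *
      (hor (fun j : Fin k => if (j : ℕ) < l then (Q : ℂ) else 0) 0)⁻¹).1.1 =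
    blk (turn (ω * x) * (Real.exp (s * x) : ℝ))
      (fun j => turn (ω * x) * -star (if (j : ℕ) < l then (Q : ℂ) *
        ((Real.exp (-(s * -x)) : ℝ) - turn (y j * -x)) else 0))
      (turn (ω * x) * ∑ j : Fin k, if (j : ℕ) < l then (Q : ℂ) ^ 2 *
        ((Real.cosh (s * x) : ℝ) - turn (y j * x)) else 0)
      (Matrix.diagonal fun j => turn (ω * x) * turn (y j * x))
      (fun j => turn (ω * x) * if (j : ℕ) < l then (Q : ℂ) *
        ((Real.exp (-(s * x)) : ℝ) - turn (y j * x)) else 0)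
      (turn (ω * x) * (Real.exp (-(s * x)) : ℝ)) := by
  rw [diagFlow, hor_mul_lev_mul_hor_inv]
  have hconj : ∀ r : ℝ, (starRingEnd ℂ) (r : ℂ) = r := Complex.conj_ofReal
  congr 1
  · ext j
    have h1 : turn (y j * -x) = star (turn (y j * x)) := by rw [← turn_neg]; ring_nf
    rw [h1, Pi.sub_apply, Matrix.vecMul_diagonal]
    simp only [Pi.smul_apply, Pi.star_apply, smul_eq_mul]
    split_ifs with hj
    · simp only [star_mul', star_sub, star_star]
      simp only [Complex.star_def, hconj]
      ring_nf
    · simp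
  · simp only [dotProduct, Matrix.mulVec_diagonal, Pi.star_apply, Finset.mul_sum, Finset.sum_div]
    rw [← Finset.sum_sub_distrib]
    refine Finset.sum_congr rfl fun j _ => ?_
    split_ifs with hj
    · simp only [Complex.star_def, hconj, Real.cosh_eq]
      push_cast
      ring
    · simp
  · ext j
    rw [Pi.sub_apply, Matrix.mulVec_diagonal]
    simp only [Pi.smul_apply, smul_eq_mul]
    split_ifs with hj
    · ring
    · simp

end Complex

/-! ### Limits of conjugated diagonal flows -/

section ComplexLimit

variable {k : ℕ}

/-- Only the remainders `δ` of the rotation numbers modulo 1 matter. The individual `Q ^ 2 * δ j`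
may diverge, but the height involves just their sum, whose limit `T` becomes the vertical
translation. The common phase survives as the scalar `υ`. -/
theorem tendsto_conj_diagFlow {Q : ℕ → ℝ} (hQ : Tendsto Q atTop atTop) {ω s : ℕ → ℝ}
    {y : ℕ → Fin k → ℝ} (h : ∀ n, (k + 2) * ω n + ∑ j, y n j = 0) {x : ℕ → ℝ} {l : ℕ} {υ : ℂ}
    {η T : ℝ} {ξ : Fin k → ℝ} (hυ : Tendsto (fun n => turn (ω n * x n)) atTop (𝓝 υ))
    (hσ : Tendsto (fun n => Q n * (s n * x n)) atTop (𝓝 η)) {δ : ℕ → Fin k → ℝ}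
    (hδint : ∀ n j, ∃ m : ℤ, y n j * x n - δ n j = m)
    (hδ : ∀ j, Tendsto (fun n => Q n * δ n j) atTop (𝓝 (ξ j)))
    (hδ0 : ∀ n (j : Fin k), l ≤ j → δ n j = 0)
    (hT : Tendsto (fun n => Q n ^ 2 * ∑ j, δ n j) atTop (𝓝 T)) {τ : Fin k → ℂ}
    (hτ : ∀ j : Fin k, τ j = if (j : ℕ) < l then -(η + 2 * Real.pi * ξ j * Complex.I) else 0) :
    Tendsto (fun n => (hor (fun j : Fin k => if (j : ℕ) < l then (Q n : ℂ) else 0) 0 *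
      diagFlow (ω n) (s n) (y n) (h n) (x n) *
      (hor (fun j : Fin k => if (j : ℕ) < l then (Q n : ℂ) else 0) 0)⁻¹).1.1) atTop
      (𝓝 (blk υ (υ • star τ) (υ * horHeight τ (-(2 * Real.pi * T))) (υ • 1) (υ • τ) υ)) := by
  have hturn : ∀ n j, turn (y n j * x n) = turn (δ n j) := fun n j => by
    obtain ⟨m, hm⟩ := hδint n j
    exact turn_eq_of_sub_eq_int hm
  have hturn' : ∀ n j, turn (y n j * -x n) = turn (-δ n j) := fun n j => by
    rw [mul_neg, turn_neg, turn_neg, hturn]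
  simp only [hor_mul_diagFlow_mul_inv_val, hturn, hturn']
  have hσ0 : Tendsto (fun n => s n * x n) atTop (𝓝 0) :=
    tendsto_zero_of_mul_tendsto (𝕜 := ℝ) hQ hσ
  have hexp : Tendsto (fun n => ((Real.exp (s n * x n) : ℝ) : ℂ)) atTop (𝓝 1) := by
    have := (Complex.continuous_ofReal.comp Real.continuous_exp).tendsto 0 |>.comp hσ0
    simpa [Function.comp_def] using this
  have hexp' : Tendsto (fun n => ((Real.exp (-(s n * x n)) : ℝ) : ℂ)) atTop (𝓝 1) := by
    have := (Complex.continuous_ofReal.comp Real.continuous_exp).tendsto 0 |>.comp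
      (by simpa using hσ0.neg)
    simpa [Function.comp_def] using this
  refine tendsto_blk ?_ ?_ ?_ ?_ ?_ ?_
  · simpa using hυ.mul hexp
  · intro j
    refine hυ.mul ?_
    simp only [Pi.star_apply, hτ]
    split_ifs with hj
    · have h1 : Tendsto (fun n => Q n * (s n * -x n)) atTop (𝓝 (-η)) := by
        simpa using hσ.neg
      have h2 : Tendsto (fun n => Q n * -δ n j) atTop (𝓝 (-ξ j)) := by
        simpa using (hδ j).neg
      have h3 := (tendsto_displacement hQ h1 h2).star.neg
      convert h3 using 2
      simp
      ring
    · simp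
  · refine hυ.mul ?_
    have h1 : ∀ j : Fin k, Tendsto (fun n => if (j : ℕ) < l then (Q n : ℂ) ^ 2 *
        (((Real.cosh (s n * x n) : ℝ) : ℂ) - turn (δ n j) + 2 * Real.pi * δ n j * Complex.I) else 0)
        atTop (𝓝 (star (τ j) * τ j / 2)) := by
      intro j
      rw [hτ]
      split_ifs with hj
      · convert tendsto_height hQ hσ (hδ j) using 2
        rw [Complex.star_def, ← Complex.normSq_eq_conj_mul_self, Complex.normSq_apply]
        simp
        ring
      · simp
    have h2 := tendsto_finsetSum Finset.univ fun j _ => h1 j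
    have h3 := ((Complex.continuous_ofReal.tendsto T).comp hT).const_mul (2 * Real.pi * Complex.I)
    convert h2.sub h3 using 2 with n
    · rw [Function.comp_apply]
      push_cast
      rw [Finset.mul_sum, Finset.mul_sum, ← Finset.sum_sub_distrib]
      refine Finset.sum_congr rfl fun j _ => ?_
      split_ifs with hj
      · ring
      · rw [hδ0 n j (not_lt.1 hj)]; simp
    · rw [horHeight, dotProduct, Finset.sum_div, RCLike.I_to_complex]
      simp only [Pi.star_apply]
      simp only [Complex.coe_algebraMap, ← Finset.sum_div]
      push_cast
      ring
  · intro i j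
    by_cases hij : i = j
    · subst hij
      simp only [Matrix.diagonal_apply_eq, Matrix.smul_apply, Matrix.one_apply_eq, smul_eq_mul]
      refine hυ.mul ?_
      have h1 := (continuous_turn.tendsto 0).comp
        (tendsto_zero_of_mul_tendsto (𝕜 := ℝ) hQ (hδ i))
      rwa [turn_zero] at h1
    · simp [hij]
  · intro j
    refine hυ.mul ?_
    simp only [hτ]
    split_ifs with hj
    · exact tendsto_displacement hQ hσ (hδ j)
    · exact tendsto_const_nhds
  · simpa using hυ.mul hexp'

/-- Values at `j < l` that are prescribed by `F (j + 2)`, except that the value at `0` makes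
the sum equal to `F 2`. -/
noncomputable def balanced (l : ℕ) (F : ℕ → ℝ) (j : ℕ) : ℝ :=
  if l ≤ j then 0 else if j = 0 then F 2 - ∑ i ∈ Finset.Ico 1 l, F (i + 2) else F (j + 2)

/-- A sum at the single scale `F 2` is what lets the height detect the exponent modulo `Q ^ 2`, and
it also fixes the rotation needed for determinant one. -/
theorem sum_balanced {l : ℕ} (hl : 1 ≤ l) (hlk : l ≤ k) (F : ℕ → ℝ) :
    ∑ j : Fin k, balanced l F j = F 2 := by
  rw [Fin.sum_univ_eq_sum_range (fun j => balanced l F j) k,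
    ← Finset.sum_subset (Finset.range_subset_range.2 hlk)
      (fun j _ hj => by simp [balanced, not_lt.1 (mt Finset.mem_range.2 hj)]),
    Finset.range_eq_Ico, Finset.sum_eq_sum_Ico_succ_bot hl, balanced]
  have : ∑ j ∈ Finset.Ico (0 + 1) l, balanced l F j = ∑ i ∈ Finset.Ico 1 l, F (i + 2) := by
    refine Finset.sum_congr rfl fun j hj => ?_
    obtain ⟨h1, h2⟩ := Finset.mem_Ico.1 hj
    simp [balanced, not_le.2 h2, show j ≠ 0 by omega]
  rw [this]
  simp [show ¬ l ≤ 0 by omega]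

theorem balanced_mul (l : ℕ) (F : ℕ → ℝ) (j : ℕ) (x : ℝ) :
    balanced l F j * x = balanced l (fun b => F b * x) j := by
  unfold balanced
  split_ifs <;> simp [sub_mul, Finset.sum_mul]

theorem balanced_sub_eq_int {l : ℕ} {F G : ℕ → ℝ} (h : ∀ b, ∃ m : ℤ, F b - G b = m) (j : ℕ) :
    ∃ m : ℤ, balanced l F j - balanced l G j = m := by
  choose m hm using h
  have hF : ∀ b, F b = m b + G b := fun b => by linarith [hm b]
  unfold balanced
  split_ifs
  · exact ⟨0, by simp⟩
  · refine ⟨m 2 - ∑ i ∈ Finset.Ico 1 l, m (i + 2), ?_⟩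
    simp only [hF, Finset.sum_add_distrib]
    push_cast
    ring
  · exact ⟨m (j + 2), hm _⟩

theorem tendsto_mul_balanced {l : ℕ} {Q : ℕ → ℝ} {F : ℕ → ℕ → ℝ} {c : ℕ → ℝ}
    (h : ∀ b, Tendsto (fun n => Q n * F n b) atTop (𝓝 (c b))) (j : ℕ) :
    Tendsto (fun n => Q n * balanced l (F n) j) atTop (𝓝 (balanced l c j)) := by
  unfold balanced
  split_ifs
  · simp
  · simp only [mul_sub, Finset.mul_sum]
    exact (h 2).sub (tendsto_finsetSum _ fun i _ => h _)
  · exact h _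

end ComplexLimit

/-! ### Powers with bounded entries in the complex case -/

section ComplexMain

variable {k : ℕ}

theorem abs_sin_sub_self_le_sq {x : ℝ} (hx : |x| ≤ 1) : |Real.sin x - x| ≤ x ^ 2 := by
  have h1 := abs_le.1 (Real.sin_bound hx)
  have h2 : |x| ^ 5 ≤ x ^ 2 := by
    rw [← sq_abs x]; exact pow_le_pow_of_le_one (abs_nonneg x) hx (by norm_num)
  have h3 : |x ^ 3| ≤ x ^ 2 := by
    rw [abs_pow, ← sq_abs x]; exact pow_le_pow_of_le_one (abs_nonneg x) hx (by norm_num)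
  obtain ⟨h4, h5⟩ := abs_le.1 h3
  rw [abs_le]
  constructor <;> linarith [sq_nonneg x, h1.1, h1.2]

/-- The exponents `0, 2, 3, …`. -/
def skipExp (i : ℕ) : ℕ := if i = 0 then 0 else i + 1

theorem skipExp_succ (i : ℕ) : skipExp (i + 1) = i + 2 := by simp [skipExp]

/-- Digits of an integer for which the loxodromic motions of `exists_cyclic_complex` have bounded
displacement. -/
theorem exists_digits_of_displacement_le {l Q : ℕ} (hl : 1 ≤ l) (hlk : l ≤ k) (hQ0 : 0 < Q) {R : ℝ}
    (hR : 0 < R) (hQ : 8 * R ≤ Q) (m : ℤ)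
    (h1 : ∀ j : Fin k, (j : ℕ) < l → Q * ‖((Real.exp (-(1 / (Q : ℝ) ^ (l + 2) * m)) : ℝ) : ℂ) -
      turn (balanced l (fun b => 1 / (Q : ℝ) ^ b) j * m)‖ ≤ R)
    (h2 : ‖∑ j : Fin k, if (j : ℕ) < l then (Q : ℂ) ^ 2 *
        ((Real.cosh (1 / (Q : ℝ) ^ (l + 2) * m) : ℝ) -
          turn (balanced l (fun b => 1 / (Q : ℝ) ^ b) j * m)) else 0‖ ≤ R) :
    ∃ a : Fin (l + 1) → ℤ, (∀ i, |(a i : ℝ)| ≤ 2 * (2 * R + k * (2 * Real.pi * R) ^ 2)) ∧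
      m = ∑ i, a i * (Q ^ skipExp i : ℕ) := by
  set Y : ℕ → ℝ := balanced l fun b => 1 / (Q : ℝ) ^ b with hY
  have hQ1 : (0 : ℝ) < Q := by exact_mod_cast hQ0
  have hbase := fun j hj => abs_le_and_exists_int_of_norm_sub_turn_le hQ1 (by linarith) (h1 j hj)
  have hb : ∀ j : Fin k, ∃ b : ℤ, |Y j * m - b| ≤ R / Q := by
    intro j
    by_cases hj : (j : ℕ) < l
    · exact (hbase j hj).2
    · refine ⟨0, ?_⟩
      have : Y j = 0 := by simp [hY, balanced, not_lt.1 hj]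
      rw [this]
      simp; positivity
  choose b hb using hb
  -- The dilation at rate `1 / Q ^ (l + 2)` bounds the exponent and thus the top digit.
  have hm : |(m : ℝ)| ≤ 2 * R * Q ^ (l + 1) := by
    have h3 := (hbase ⟨0, by omega⟩ (by simp; omega)).1
    rw [abs_mul, abs_of_pos (by positivity)] at h3
    rw [div_mul_eq_mul_div, one_mul, div_le_div_iff₀ (by positivity) hQ1] at h3
    refine le_of_mul_le_mul_right (h3.trans_eq ?_) hQ1
    ring
  -- The imaginary part of the height is `Q ^ 2` times a sum of sines. To first order these are `2π
  -- (Y j * m - b j)`, and the `Y j * m` sum to `m / Q ^ 2`, so `m` lies near `(∑ j, b j) * Q ^ 2`;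
  -- the errors at scale `1 / Q ^ 2` add the term with `k`.
  have hmid : |(m : ℝ) - (∑ j, b j : ℤ) * Q ^ 2| ≤ R + k * (2 * Real.pi * R) ^ 2 := by
    have hsum : ∑ j : Fin k, Y j * m = m / Q ^ 2 := by
      rw [← Finset.sum_mul, hY, sum_balanced hl hlk]; ring
    have him : (Q : ℝ) ^ 2 * |∑ j : Fin k, Real.sin (2 * Real.pi * (Y j * m))| ≤ R := by
      refine le_trans (le_of_eq ?_) ((Complex.abs_im_le_norm _).trans h2)
      have h3 : (∑ j : Fin k, if (j : ℕ) < l then (Q : ℂ) ^ 2 *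
          ((Real.cosh (1 / (Q : ℝ) ^ (l + 2) * m) : ℝ) - turn (Y j * m)) else 0).im =
          -((Q : ℝ) ^ 2 * ∑ j : Fin k, Real.sin (2 * Real.pi * (Y j * m))) := by
        rw [Complex.im_sum, Finset.mul_sum, ← Finset.sum_neg_distrib]
        refine Finset.sum_congr rfl fun j _ => ?_
        split_ifs with hj
        · rw [show ((Q : ℂ) ^ 2) = (((Q : ℝ) ^ 2 : ℝ) : ℂ) by push_cast; rfl,
            Complex.im_ofReal_mul, Complex.sub_im, Complex.ofReal_im, im_turn]
          ring
        · have : Y j = 0 := by simp [hY, balanced, not_lt.1 hj]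
          simp [this]
      rw [h3, abs_neg, abs_mul, abs_of_pos (show (0 : ℝ) < (Q : ℝ) ^ 2 by positivity)]
    have hterm : ∀ j : Fin k, |Real.sin (2 * Real.pi * (Y j * m)) - 2 * Real.pi * (Y j * m - b j)| ≤
        (2 * Real.pi * R) ^ 2 / Q ^ 2 := by
      intro j
      have h3 : Real.sin (2 * Real.pi * (Y j * m)) = Real.sin (2 * Real.pi * (Y j * m - b j)) := by
        rw [← im_turn, ← im_turn, turn_eq_of_sub_eq_int (m := b j)]
        ring
      have h4 : |2 * Real.pi * (Y j * m - b j)| ≤ 2 * Real.pi * R / Q := by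
        rw [abs_mul, abs_of_pos (by positivity), mul_div_assoc]
        exact mul_le_mul_of_nonneg_left (hb j) (by positivity)
      -- This is where `8 * R ≤ Q` is needed, as `2 * π < 8`.
      have h5 : 2 * Real.pi * R / Q ≤ 1 := by
        rw [div_le_one hQ1]
        nlinarith [Real.pi_lt_four]
      rw [h3]
      refine (abs_sin_sub_self_le_sq (h4.trans h5)).trans ?_
      rw [← sq_abs, ← div_pow]
      gcongr
    have hsum' := Finset.abs_sum_le_sum_abs
      (fun j : Fin k => Real.sin (2 * Real.pi * (Y j * m)) - 2 * Real.pi * (Y j * m - b j))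
      Finset.univ
    have hsum'' := Finset.sum_le_sum fun (j : Fin k) (_ : j ∈ Finset.univ) => hterm j
    have h6 := hsum'.trans hsum''
    rw [Finset.sum_sub_distrib, ← Finset.mul_sum, Finset.sum_sub_distrib, hsum, Finset.sum_const,
      Finset.card_univ, Fintype.card_fin, nsmul_eq_mul, mul_div_assoc', le_div_iff₀ (by positivity),
      abs_sub_comm] at h6
    set S := ∑ j : Fin k, Real.sin (2 * Real.pi * (Y j * m))
    have h7 : |2 * Real.pi * (m / (Q : ℝ) ^ 2 - ∑ j, (b j : ℝ))| * Q ^ 2 ≤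
        R + k * (2 * Real.pi * R) ^ 2 := by
      have h8 := abs_sub_abs_le_abs_sub (2 * Real.pi * (m / (Q : ℝ) ^ 2 - ∑ j, (b j : ℝ))) S
      have h9 : 0 ≤ (Q : ℝ) ^ 2 := by positivity
      nlinarith
    have h8 : |2 * Real.pi * (m / (Q : ℝ) ^ 2 - ∑ j, (b j : ℝ))| * Q ^ 2 =
        2 * Real.pi * |(m : ℝ) - (∑ j, b j : ℤ) * Q ^ 2| := by
      rw [abs_mul, abs_of_pos (show 0 < 2 * Real.pi by positivity), mul_assoc]
      congr 1
      nth_rw 2 [← abs_of_pos (show (0 : ℝ) < (Q : ℝ) ^ 2 by positivity)]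
      rw [← abs_mul]
      congr 1
      push_cast
      field_simp
    rw [h8] at h7
    refine le_trans ?_ h7
    have := Real.pi_gt_three
    nlinarith [abs_nonneg ((m : ℝ) - (∑ j, b j : ℤ) * Q ^ 2)]
  have hkR : 0 ≤ k * (2 * Real.pi * R) ^ 2 := by positivity
  refine exists_digits l (fun i => Q ^ skipExp i) (by simp [skipExp]) (fun i => ?_)
    (fun i => by positivity) (by positivity) m ?_ fun i hi => ?_
  · have h3 : skipExp i ≤ skipExp (i + 1) := by
      rw [skipExp_succ]; unfold skipExp; split_ifs <;> omega
    exact pow_dvd_pow _ h3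
  · obtain ⟨l, rfl⟩ : ∃ l', l = l' + 1 := ⟨l - 1, by omega⟩
    rw [skipExp_succ]
    push_cast
    refine hm.trans ?_
    gcongr
    linarith
  -- The gap from `1` to `Q ^ 2` is controlled by the height; the later levels come from the
  -- individual rotations.
  · rcases Nat.eq_zero_or_pos i with rfl | hi0
    · refine ⟨∑ j, b j, ?_⟩
      have h3 : |(m : ℝ) - (∑ j, b j : ℤ) * ((Q ^ skipExp (0 + 1) : ℕ) : ℝ)| ≤
          R + k * (2 * Real.pi * R) ^ 2 := by
        rw [skipExp_succ, Nat.cast_pow]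
        exact hmid
      refine h3.trans ?_
      simp [skipExp]
      linarith
    · obtain ⟨i, rfl⟩ : ∃ i', i = i' + 1 := ⟨i - 1, by omega⟩
      refine ⟨b ⟨i + 1, by omega⟩, ?_⟩
      have h3 := hb ⟨i + 1, by omega⟩
      have h4 : Y (i + 1) = 1 / (Q : ℝ) ^ (i + 3) := by
        simp [hY, balanced, show ¬ l ≤ i + 1 by omega]
      simp only [h4] at h3
      rw [skipExp_succ, skipExp_succ]
      push_cast
      have h5 : (m : ℝ) - b ⟨i + 1, by omega⟩ * (Q : ℝ) ^ (i + 3) =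
          (1 / (Q : ℝ) ^ (i + 3) * m - b ⟨i + 1, by omega⟩) * (Q : ℝ) ^ (i + 3) := by
        field_simp
      rw [show i + 1 + 2 = i + 3 by ring, h5, abs_mul,
        abs_of_pos (show (0 : ℝ) < (Q : ℝ) ^ (i + 3) by positivity)]
      calc _ ≤ R / Q * (Q : ℝ) ^ (i + 3) := by gcongr
        _ = R * (Q : ℝ) ^ (i + 2) := by field_simp; ring
        _ ≤ _ := by gcongr; linarith

/-- The loxodromic one-parameter groups whose lattices degenerate. -/
noncomputable def cxFlow {l : ℕ} (hl : 1 ≤ l) (hlk : l ≤ k) (Q : ℕ) (x : ℝ) : SUform ℂ k :=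
  hor (fun j : Fin k => if (j : ℕ) < l then ((Q : ℝ) : ℂ) else 0) 0 *
    diagFlow (-(1 / (Q : ℝ) ^ 2) / (k + 2)) (1 / (Q : ℝ) ^ (l + 2))
      (fun j => balanced l (fun b => 1 / (Q : ℝ) ^ b) j)
      (by rw [sum_balanced hl hlk, mul_div_cancel₀ _ (by positivity), neg_add_cancel]) x *
    (hor (fun j : Fin k => if (j : ℕ) < l then ((Q : ℝ) : ℂ) else 0) 0)⁻¹

theorem cxFlow_zpow {l : ℕ} (hl : 1 ≤ l) (hlk : l ≤ k) (Q : ℕ) (m : ℤ) :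
    cxFlow hl hlk Q 1 ^ m = cxFlow hl hlk Q m := by
  rw [cxFlow, conj_zpow', zpow_eq_of_map_add (diagFlow_add _ _ _ _)]
  rfl

theorem isConvexCocompact_cxFlow {l : ℕ} (hl : 1 ≤ l) (hlk : l ≤ k) {Q : ℕ} (hQ : 0 < Q) :
    IsConvexCocompact ℂ k (zpowersHom (SUform ℂ k) (cxFlow hl hlk Q 1)) := by
  refine isConvexCocompact_zpowersHom_conj_lev _ _ _ _ _ _ _ ?_
  rw [norm_mul, norm_turn, one_mul, Complex.norm_real, Real.norm_eq_abs, Real.abs_exp,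
    Real.one_lt_exp_iff]
  positivity

theorem exists_bounded_digits_cxFlow {l : ℕ} (hl : 1 ≤ l) (hlk : l ≤ k) {Q : ℕ → ℕ}
    (hQ : Tendsto (fun n => (Q n : ℝ)) atTop atTop) {K : Set (SUform ℂ k)} (hK : IsCompact K) :
    ∃ C : ℕ, ∀ᶠ n in atTop, ∀ m : ℤ, cxFlow hl hlk (Q n) m ∈ K → ∃ a : Fin (l + 1) → ℤ,
      (∀ i, |a i| ≤ C) ∧ m = ∑ i, a i * (Q n ^ skipExp i : ℕ) := by
  obtain ⟨R, hR, hKR⟩ := SUform.exists_norm_le hK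
  refine ⟨⌈2 * (2 * R + k * (2 * Real.pi * R) ^ 2)⌉₊, ?_⟩
  filter_upwards [hQ.eventually_ge_atTop (8 * R)] with n hn m hm
  have hQ0 : (0 : ℝ) < Q n := by linarith
  have hent := hKR _ hm
  simp only [cxFlow, hor_mul_diagFlow_mul_inv_val] at hent
  obtain ⟨a, ha, ham⟩ := exists_digits_of_displacement_le hl hlk (by exact_mod_cast hQ0) hR hn m
    (fun j hj => by
      have := hent (midx j) (Fin.last _)
      rw [blk_mid_last, norm_mul, norm_turn, one_mul, if_pos hj, norm_mul, Complex.norm_real,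
        Real.norm_eq_abs, abs_of_pos hQ0] at this
      exact this) (by
      have := hent 0 (Fin.last _)
      rw [blk_zero_last, norm_mul, norm_turn, one_mul] at this
      exact this)
  refine ⟨a, fun i => ?_, ham⟩
  have h1 := (ha i).trans (Nat.le_ceil _)
  exact_mod_cast h1

end ComplexMain

/-! ### The limit group in the complex case -/

section ComplexTheorem

variable {k : ℕ}

theorem balanced_add (l : ℕ) (F G : ℕ → ℝ) (j : ℕ) :
    balanced l (fun b => F b + G b) j = balanced l F j + balanced l G j := by
  unfold balanced
  split_ifs
  · simp
  · rw [Finset.sum_add_distrib]; ring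
  · rfl

/-- The coefficient that contributes to the turn with denominator `Q ^ b`. -/
def skipCoeff {l : ℕ} (a : Fin (l + 1) → ℤ) (b : ℕ) : ℝ :=
  ∑ i : Fin (l + 1), if skipExp i + 1 = b then (a i : ℝ) else 0

theorem skipCoeff_add {l : ℕ} (a a' : Fin (l + 1) → ℤ) (b : ℕ) :
    skipCoeff (a + a') b = skipCoeff a b + skipCoeff a' b := by
  rw [skipCoeff, skipCoeff, skipCoeff, ← Finset.sum_add_distrib]
  refine Finset.sum_congr rfl fun i _ => ?_
  split_ifs <;> simp

theorem skipExp_succ_eq_iff (i j : ℕ) : skipExp i + 1 = j + 2 ↔ i = j ∧ 1 ≤ j := by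
  unfold skipExp
  split_ifs <;> omega

/-- The exponent `1` is skipped, so the imaginary parts of each limit translation sum to zero. -/
theorem skipCoeff_two {l : ℕ} (a : Fin (l + 1) → ℤ) : skipCoeff a 2 = 0 := by
  refine Finset.sum_eq_zero fun i _ => if_neg ?_
  rw [show 2 = 0 + 2 from rfl, skipExp_succ_eq_iff]
  omega

theorem skipCoeff_add_two {l : ℕ} (a : Fin (l + 1) → ℤ) {j : ℕ} (hj : 1 ≤ j) (hjl : j < l + 1) :
    skipCoeff a (j + 2) = a ⟨j, hjl⟩ := by
  rw [skipCoeff, Finset.sum_eq_single ⟨j, hjl⟩]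
  · rw [if_pos ((skipExp_succ_eq_iff _ _).2 ⟨rfl, hj⟩)]
  · intro i _ hi
    rw [if_neg]
    rw [skipExp_succ_eq_iff]
    rintro ⟨h, _⟩
    exact hi (Fin.ext h)
  · simp

theorem skipCoeff_single {l : ℕ} (i : Fin (l + 1)) (b : ℕ) :
    skipCoeff (Pi.single i 1) b = if skipExp i + 1 = b then 1 else 0 := by
  rw [skipCoeff, Finset.sum_eq_single i]
  · simp
  · intro j _ hj
    simp [hj]
  · simp

/-- The horizontal part of the limit translations. -/
noncomputable def cxTrans (k : ℕ) {l : ℕ} (a : Fin (l + 1) → ℤ) (j : Fin k) : ℂ :=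
  if (j : ℕ) < l then -(((a (Fin.last l) : ℝ) : ℂ) +
    2 * Real.pi * (balanced l (skipCoeff a) j : ℝ) * Complex.I) else 0

theorem cxTrans_add {l : ℕ} (a a' : Fin (l + 1) → ℤ) :
    cxTrans k (a + a') = cxTrans k a + cxTrans k a' := by
  ext j
  rw [Pi.add_apply, cxTrans, cxTrans, cxTrans]
  split_ifs
  · rw [show skipCoeff (a + a') = fun b => skipCoeff a b + skipCoeff a' b from
      funext (skipCoeff_add a a'), balanced_add]
    push_cast [Pi.add_apply]
    ring
  · simp

/-- Real parts are constant along the first `l` coordinates, so the imaginary part of the Hermitian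
product only sees sums of imaginary parts, and these vanish. Hence the limit translations commute.
-/
theorem cxTrans_isotropic {l : ℕ} (hl : 1 ≤ l) (hlk : l ≤ k) (a a' : Fin (l + 1) → ℤ) :
    star (cxTrans k a) ⬝ᵥ cxTrans k a' = star (cxTrans k a') ⬝ᵥ cxTrans k a := by
  have h0 : ∀ a : Fin (l + 1) → ℤ, ∑ j : Fin k, ((balanced l (skipCoeff a) j : ℝ) : ℂ) = 0 := by
    intro a
    rw [← Complex.ofReal_sum, sum_balanced hl hlk, skipCoeff_two, Complex.ofReal_zero]
  rw [← sub_eq_zero, dotProduct, dotProduct, ← Finset.sum_sub_distrib]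
  have h1 : ∀ j : Fin k, star (cxTrans k a) j * cxTrans k a' j -
      star (cxTrans k a') j * cxTrans k a j =
      (4 * Real.pi * Complex.I * (a (Fin.last l) : ℝ)) * (balanced l (skipCoeff a') j : ℝ) -
      (4 * Real.pi * Complex.I * (a' (Fin.last l) : ℝ)) * (balanced l (skipCoeff a) j : ℝ) := by
    intro j
    simp only [Pi.star_apply, cxTrans]
    split_ifs with hj
    · simp
      ring
    · simp [balanced, not_lt.1 hj]
  simp only [h1]
  rw [Finset.sum_sub_distrib, ← Finset.mul_sum, ← Finset.mul_sum, h0, h0]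
  simp

/-- The limit group. -/
noncomputable def cxLimit {l : ℕ} (hl : 1 ≤ l) (hlk : l ≤ k) :
    Multiplicative (Fin (l + 1) → ℤ) →* SUform ℂ k :=
  MonoidHom.mk' (fun a => cen k (a.toAdd ⟨1, by omega⟩) *
    hor (cxTrans k a.toAdd) (-(2 * Real.pi * a.toAdd 0))) fun a b => by
      rw [cen_mul_hor_mul _ _ _ _ (cxTrans_isotropic hl hlk _ _), ← cxTrans_add, toAdd_mul,
        Pi.add_apply, Pi.add_apply]
      congr 2
      push_cast
      ring

theorem cxLimit_ofAdd_val {l : ℕ} (hl : 1 ≤ l) (hlk : l ≤ k) (a : Fin (l + 1) → ℤ) :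
    (cxLimit hl hlk (.ofAdd a)).1.1 =
      blk (turn (-a ⟨1, by omega⟩ / (k + 2))) (turn (-a ⟨1, by omega⟩ / (k + 2)) • star (cxTrans k a))
        (turn (-a ⟨1, by omega⟩ / (k + 2)) * horHeight (cxTrans k a) (-(2 * Real.pi * a 0)))
        (turn (-a ⟨1, by omega⟩ / (k + 2)) • 1)
        (turn (-a ⟨1, by omega⟩ / (k + 2)) • cxTrans k a) (turn (-a ⟨1, by omega⟩ / (k + 2))) := by
  rw [← cen_mul_hor_val]
  rfl

theorem tendsto_cxFlow_zpow {l : ℕ} (hl : 1 ≤ l) (hlk : l ≤ k) {Q : ℕ → ℕ}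
    (hQ : Tendsto (fun n => (Q n : ℝ)) atTop atTop) (hQ0 : ∀ n, 0 < Q n)
    (hdvd : ∀ n, k + 2 ∣ Q n) (i : Fin (l + 1)) :
    Tendsto (fun n => cxFlow hl hlk (Q n) 1 ^ ((Q n ^ skipExp i : ℕ) : ℤ)) atTop
      (𝓝 (cxLimit hl hlk (.ofAdd (Pi.single i 1)))) := by
  simp only [cxFlow_zpow]
  rw [SUform.tendsto_iff, cxLimit_ofAdd_val]
  simp only [cxFlow]
  have hQR : ∀ n, (0 : ℝ) < Q n := fun n => by exact_mod_cast hQ0 n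
  refine tendsto_conj_diagFlow (δ := fun n j => balanced l (powFrac (Q n) (skipExp i)) j)
    (η := (((Pi.single i 1 : Fin (l + 1) → ℤ) (Fin.last l) : ℤ) : ℝ))
    (T := (((Pi.single i 1 : Fin (l + 1) → ℤ) 0 : ℤ) : ℝ))
    (ξ := fun j => balanced l (skipCoeff (Pi.single i 1)) j) hQ
    (l := l) _ ?_ ?_ ?_ ?_ ?_ ?_ fun j => rfl
  -- The common phase tends to `1` for the exponent `1`, is a constant root of unity for `Q ^ 2`,
  -- and is a whole turn for the higher powers because `k + 2` divides `Q`.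
  · rcases Nat.lt_trichotomy i 1 with hi | hi | hi
    · have hi0 : i = 0 := Fin.ext (by simpa using hi)
      subst hi0
      have h1 : (Pi.single (0 : Fin (l + 1)) 1 : Fin (l + 1) → ℤ) ⟨1, by omega⟩ = 0 :=
        Pi.single_eq_of_ne (by simp [Fin.ext_iff]) _
      rw [h1]
      have h2 : Tendsto (fun n => -(1 / (Q n : ℝ) ^ 2) / ((k : ℝ) + 2)) atTop
          (𝓝 (-0 / ((k : ℝ) + 2))) := by
        refine Tendsto.div_const (Tendsto.neg ?_) _
        simpa using ((tendsto_inv_atTop_zero.comp hQ).pow 2)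
      have h3 := (continuous_turn.tendsto _).comp h2
      simpa [skipExp, Function.comp_def] using h3
    · have hi1 : i = ⟨1, by omega⟩ := Fin.ext hi
      rw [← hi1, Pi.single_eq_same, hi]
      refine tendsto_const_nhds.congr fun n => ?_
      congr 1
      have := hQR n
      simp [skipExp]
      field_simp
    · have hi1 : (⟨1, by omega⟩ : Fin (l + 1)) ≠ i := fun h => by simp [← h] at hi
      rw [Pi.single_eq_of_ne hi1]
      refine tendsto_const_nhds.congr fun n => ?_
      obtain ⟨c, hc⟩ := hdvd n
      have h2 : skipExp i = (i - 2) + 1 + 2 := by unfold skipExp; split_ifs <;> omega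
      have h3 : -(1 / (Q n : ℝ) ^ 2) / (k + 2) * ((((Q n ^ skipExp i : ℕ) : ℤ)) : ℝ) -
          -((0 : ℤ) : ℝ) / (k + 2) = ((-((Q n : ℤ) ^ ((i : ℕ) - 2) * c) : ℤ) : ℝ) := by
        have h4 := (hQR n).ne'
        rw [h2]
        push_cast
        rw [pow_add, pow_succ _ ((i : ℕ) - 2)]
        field_simp
        have : (Q n : ℝ) = (k + 2) * c := by exact_mod_cast hc
        rw [this]
        ring
      exact (turn_eq_of_sub_eq_int h3).symm
  · have h1 := tendsto_mul_powFrac hQ (skipExp i) (l + 2)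
    have h2 : (if skipExp i + 1 = l + 2 then (1 : ℝ) else 0) =
        ((Pi.single i 1 : Fin (l + 1) → ℤ) (Fin.last l) : ℤ) := by
      simp only [skipExp_succ_eq_iff, Pi.single_apply, Fin.ext_iff, Fin.val_last]
      split_ifs <;> first | omega | simp
    rw [h2] at h1
    refine h1.congr fun n => ?_
    have : ¬ l + 2 ≤ skipExp i := by
      have := i.2
      unfold skipExp; split_ifs <;> omega
    rw [powFrac, if_neg this]
    push_cast
    ring
  · intro n j
    rw [balanced_mul]
    refine balanced_sub_eq_int (fun b => ?_) j
    obtain ⟨m, hm⟩ := exists_int_pow_div_sub_powFrac (hQ0 n) (skipExp i) b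
    refine ⟨m, ?_⟩
    rw [← hm]
    push_cast
    ring
  · intro j
    refine tendsto_mul_balanced (fun b => ?_) j
    rw [skipCoeff_single]
    exact tendsto_mul_powFrac hQ _ _
  · intro n j hj
    simp [balanced, hj]
  -- The remainders sum to `powFrac Q (skipExp i) 2`, which is `1 / Q ^ 2` for `i = 0` and zero
  -- otherwise: only the generator itself contributes to the vertical part.
  · simp only [sum_balanced hl hlk]
    rcases eq_or_ne i 0 with rfl | hi
    · refine tendsto_const_nhds.congr fun n => ?_
      have := hQR n
      simp [powFrac, skipExp]
      field_simp
    · have h1 : (i : ℕ) ≠ 0 := fun h => hi (Fin.ext h)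
      have h2 : 2 ≤ skipExp i := by
        rw [skipExp, if_neg h1]; omega
      simp [powFrac, h2, Pi.single_eq_of_ne hi.symm]

/-- Coordinates of the limit group. -/
noncomputable def cxCoord (hk : 0 < k) (l : ℕ) (g : SUform ℂ k) (i : Fin (l + 1)) : ℝ :=
  if (i : ℕ) = 0 then
    -(g.1.1 0 (Fin.last _) * star (g.1.1 (Fin.last _) (Fin.last _))).im / (2 * Real.pi)
  else if (i : ℕ) = l then
    -(g.1.1 (midx ⟨0, hk⟩) (Fin.last _) * star (g.1.1 (Fin.last _) (Fin.last _))).re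
  else if hi : (i : ℕ) < k then
    -(g.1.1 (midx ⟨i, hi⟩) (Fin.last _) * star (g.1.1 (Fin.last _) (Fin.last _))).im / (2 * Real.pi)
  else 0

theorem continuous_cxCoord (hk : 0 < k) (l : ℕ) : Continuous (cxCoord hk l) := by
  refine continuous_pi fun i => ?_
  have h : ∀ i j i' j', Continuous fun g : SUform ℂ k => g.1.1 i j * star (g.1.1 i' j') :=
    fun i j i' j' => (SUform.continuous_apply i j).mul (SUform.continuous_apply i' j').star
  unfold cxCoord
  split_ifs
  · exact (Complex.continuous_im.comp (h _ _ _ _)).neg.div_const _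
  · exact (Complex.continuous_re.comp (h _ _ _ _)).neg
  · exact (Complex.continuous_im.comp (h _ _ _ _)).neg.div_const _
  · exact continuous_const

/-- Multiplying by the conjugate of the last entry cancels the central phase. The height then gives
digit `0`, the common real part digit `l`, and the imaginary parts the others; the imaginary part of
the first coordinate is avoided, as it holds the balancing sum. -/
theorem cxCoord_cxLimit {l : ℕ} (hl : 1 ≤ l) (hlk : l ≤ k) (a : Fin (l + 1) → ℤ)
    (i : Fin (l + 1)) : cxCoord (by omega) l (cxLimit hl hlk (.ofAdd a)) i = a i := by
  have hpi := Real.pi_pos.ne'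
  rw [cxCoord, cxLimit_ofAdd_val]
  have hu : ∀ (x : ℝ) (z : ℂ), turn x * z * star (turn x) = z := fun x z => by
    rw [mul_comm, ← mul_assoc, star_turn_mul_self, one_mul]
  have hi2 := i.2
  simp only [blk_zero_last, blk_last_last, blk_mid_last, Pi.smul_apply, smul_eq_mul, hu]
  split_ifs with h1 h2 h3
  · have hi : i = 0 := Fin.ext h1
    rw [horHeight, star_dotProduct_self, hi]
    simp [-Complex.ofReal_pow]
  · have hi : i = Fin.last l := Fin.ext h2
    rw [cxTrans, if_pos (by simp; omega), hi]
    simp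
  · rw [cxTrans, if_pos (by simp; omega)]
    have h4 : balanced l (skipCoeff a) i = a i := by
      rw [balanced, if_neg (by omega), if_neg h1, skipCoeff_add_two a (by omega) hi2]
    simp [h4]
  · omega

theorem exists_cyclic_complex {l : ℕ} (hl : 1 ≤ l) (hlk : l ≤ k) :
    ∃ (ρ : ℕ → Multiplicative ℤ →* SUform ℂ k) (ρ' : Multiplicative ℤ →* SUform ℂ k)
      (L : ClosedSubgroup (SUform ℂ k)),
      (∀ n, IsConvexCocompact ℂ k (ρ n)) ∧
      ConvergesAlgebraically ρ ρ' ∧ IsDiscreteFaithful ρ' ∧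
      ConvergesGeometrically ρ L ∧
      Nonempty (L.toSubgroup ≃ₜ* Multiplicative (Fin (l + 1) → ℤ)) := by
  -- Multiples of `k + 2`, so that the central phases of the higher powers are trivial.
  let Q : ℕ → ℕ := fun n => (k + 2) * (n + 1)
  have hQ0 : ∀ n, 0 < Q n := fun n => by positivity
  have hQ : Tendsto (fun n => (Q n : ℝ)) atTop atTop := by
    refine tendsto_natCast_atTop_atTop.comp (tendsto_atTop_mono (fun n => ?_) tendsto_id)
    simp only [id, Q]
    nlinarith
  have hcc := fun n => isConvexCocompact_cxFlow hl hlk (hQ0 n)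
  obtain ⟨ρ', L, h1, h2, h3, h4⟩ := exists_cyclic_geometric_limit
    (fun n => cxFlow hl hlk (Q n) 1) (fun n i => ((Q n ^ skipExp i : ℕ) : ℤ)) (cxLimit hl hlk)
    (fun n => by simp [skipExp])
    (tendsto_cxFlow_zpow hl hlk hQ hQ0 fun n => Dvd.intro _ rfl)
    (fun K hK => by
      simp only [cxFlow_zpow]
      exact exists_bounded_digits_cxFlow hl hlk hQ hK)
    (cxCoord (by omega) l) (continuous_cxCoord _ _) (cxCoord_cxLimit hl hlk)
    (fun n => (hcc n).2.1)
  exact ⟨_, ρ', L, hcc, h1, h2, h3, h4⟩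

end ComplexTheorem

/-! ### Rotations of planes and limits of their conjugates -/

section Real

variable {k l : ℕ}

/-- A splitting of `k` coordinates into `l` planes and a rest. -/
noncomputable def planeEquiv (h : 2 * l ≤ k) : Fin k ≃ (Fin l ⊕ Fin l) ⊕ Fin (k - 2 * l) :=
  Fintype.equivOfCardEq (by simp; omega)

/-- The vector with the given components in the `l` planes. -/
noncomputable def planeVec (h : 2 * l ≤ k) (w : Fin l → ℂ) : Fin k → ℝ := fun i =>
  Sum.elim (Sum.elim (fun j => (w j).re) fun j => (w j).im) 0 (planeEquiv h i)

/-- The multiplication with complex numbers in the `l` planes. -/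
noncomputable def planeMul (h : 2 * l ≤ k) (c : Fin l → ℂ) : Matrix (Fin k) (Fin k) ℝ :=
  (Matrix.fromBlocks (Matrix.fromBlocks (.diagonal fun j => (c j).re)
    (-.diagonal fun j => (c j).im) (.diagonal fun j => (c j).im) (.diagonal fun j => (c j).re))
    0 0 1).submatrix (planeEquiv h) (planeEquiv h)

variable (h : 2 * l ≤ k)

theorem planeMul_mulVec (c w : Fin l → ℂ) :
    planeMul h c *ᵥ planeVec h w = planeVec h (c * w) := by
  have h1 : planeVec h w ∘ (planeEquiv h).symm =
      Sum.elim (Sum.elim (fun j => (w j).re) fun j => (w j).im) 0 := by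
    ext i; simp [planeVec]
  rw [planeMul, Matrix.submatrix_mulVec_equiv, h1, Matrix.fromBlocks_mulVec]
  ext i
  rw [Function.comp_apply, planeVec, Sum.elim_comp_inl, Sum.elim_comp_inr,
    Matrix.fromBlocks_mulVec]
  rcases planeEquiv h i with (j | j) | j
  · simp [Matrix.mulVec_diagonal]
    ring
  · simp [Matrix.mulVec_diagonal]
    ring
  · simp

theorem planeMul_mul (c c' : Fin l → ℂ) :
    planeMul h c * planeMul h c' = planeMul h (c * c') := by
  rw [planeMul, planeMul, Matrix.submatrix_mul_equiv, Matrix.fromBlocks_multiply, planeMul]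
  congr 1
  simp only [Matrix.fromBlocks_multiply, mul_one, Matrix.diagonal_mul_diagonal, Matrix.neg_mul, Matrix.mul_neg]
  ext ((i | i) | i) ((j | j) | j) <;> simp [Matrix.diagonal_apply] <;>
    split_ifs <;> ring

theorem planeMul_transpose (c : Fin l → ℂ) : (planeMul h c)ᵀ = planeMul h (star c) := by
  rw [planeMul, Matrix.transpose_submatrix, Matrix.fromBlocks_transpose,
    Matrix.fromBlocks_transpose, planeMul]
  congr 1
  ext ((i | i) | i) ((j | j) | j) <;> simp [Matrix.diagonal_apply]

theorem planeMul_one : planeMul h 1 = 1 := by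
  rw [planeMul]
  simp

theorem dotProduct_planeVec (w w' : Fin l → ℂ) :
    planeVec h w ⬝ᵥ planeVec h w' = ∑ j, (star (w j) * w' j).re := by
  rw [dotProduct, ← (planeEquiv h).symm.sum_comp]
  simp [planeVec, Finset.sum_add_distrib]

theorem planeVec_add (w w' : Fin l → ℂ) :
    planeVec h (w + w') = planeVec h w + planeVec h w' := by
  ext i
  simp only [planeVec, Pi.add_apply]
  rcases planeEquiv h i with (j | j) | j <;> simp

theorem planeVec_smul (r : ℝ) (w : Fin l → ℂ) :
    planeVec h (fun j => r * w j) = r • planeVec h w := by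
  ext i
  simp only [planeVec, Pi.smul_apply]
  rcases planeEquiv h i with (j | j) | j <;> simp

theorem planeVec_symm_re (w : Fin l → ℂ) (j : Fin l) :
    planeVec h w ((planeEquiv h).symm (.inl (.inl j))) = (w j).re := by
  simp [planeVec]

theorem planeVec_symm_im (w : Fin l → ℂ) (j : Fin l) :
    planeVec h w ((planeEquiv h).symm (.inl (.inr j))) = (w j).im := by
  simp [planeVec]

theorem continuous_planeMul : Continuous (planeMul h) := by
  unfold planeMul
  refine Continuous.matrix_submatrix ?_ _ _
  have h1 : Continuous fun c : Fin l → ℂ => Matrix.diagonal fun j => (c j).re :=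
    Continuous.matrix_diagonal (by fun_prop)
  have h2 : Continuous fun c : Fin l → ℂ => Matrix.diagonal fun j => (c j).im :=
    Continuous.matrix_diagonal (by fun_prop)
  exact Continuous.matrix_fromBlocks (Continuous.matrix_fromBlocks h1 h2.neg h2 h1)
    continuous_const continuous_const continuous_const

theorem continuous_planeVec : Continuous (planeVec h) := by
  refine continuous_pi fun i => ?_
  unfold planeVec
  rcases planeEquiv h i with (j | j) | j <;> simp <;> fun_prop

theorem planeMul_turn_transpose_mul (y : Fin l → ℝ) :
    (planeMul h fun j => turn (y j))ᵀ * planeMul h (fun j => turn (y j)) = 1 := by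
  rw [planeMul_transpose, planeMul_mul, ← planeMul_one h]
  congr 1
  ext j
  exact star_turn_mul_self _

/-- Each such rotation is the square of the rotation by half the angles, an orthogonal matrix. -/
theorem det_planeMul_turn (y : Fin l → ℝ) : (planeMul h fun j => turn (y j)).det = 1 := by
  have h1 : (planeMul h fun j => turn (y j)) =
      planeMul h (fun j => turn (y j / 2)) * planeMul h (fun j => turn (y j / 2)) := by
    rw [planeMul_mul]
    congr 1
    ext j
    rw [Pi.mul_apply, ← turn_add, add_halves]
  have h2 := congrArg Matrix.det (planeMul_turn_transpose_mul h fun j => y j / 2)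
  rw [Matrix.det_mul, Matrix.det_transpose, Matrix.det_one] at h2
  rw [h1, Matrix.det_mul, h2]

/-- The one-parameter groups of `SO(1, k+1)` that dilate and rotate `l` planes. -/
noncomputable def planeFlow (s : ℝ) (y : Fin l → ℝ) (x : ℝ) : SUform ℝ k :=
  lev (Real.exp (s * x)) (Real.exp (-(s * x))) (planeMul h fun j => turn (y j * x))
    (by rw [star_trivial, ← Real.exp_add]; simp)
    (by rw [Matrix.conjTranspose_eq_transpose_of_trivial, planeMul_turn_transpose_mul])
    (by rw [det_planeMul_turn, one_mul, ← Real.exp_add]; simp)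

theorem planeFlow_add (s : ℝ) (y : Fin l → ℝ) (x x' : ℝ) :
    planeFlow h s y (x + x') = planeFlow h s y x * planeFlow h s y x' := by
  refine SUform.ext ?_
  rw [SUform.mul_val]
  simp only [planeFlow, lev, SUform.mk, blk_mul, planeMul_mul]
  congr 1
  · rw [mul_add, Real.exp_add]
  · simp
  · simp
  · congr 1
    ext j
    rw [mul_add, turn_add, Pi.mul_apply]
  · simp
  · rw [mul_add, neg_add, Real.exp_add]

theorem continuous_planeFlow (s : ℝ) (y : Fin l → ℝ) : Continuous (planeFlow h s y) := by
  rw [SUform.continuous_iff]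
  simp only [planeFlow, lev, SUform.mk]
  refine continuous_blk (by fun_prop) continuous_const continuous_const
    ((continuous_planeMul h).comp ?_) continuous_const (by fun_prop)
  exact continuous_pi fun j => continuous_turn.comp (by fun_prop)

theorem hor_mul_planeFlow_mul_inv_val (s : ℝ) (y : Fin l → ℝ) (x Q : ℝ) :
    (hor (planeVec h fun _ => (Q : ℂ)) 0 * planeFlow h s y x *
      (hor (planeVec h fun _ => (Q : ℂ)) 0)⁻¹).1.1 =
    blk (Real.exp (s * x))
      (planeVec h fun j => -((Q : ℂ) * ((Real.exp (-(s * -x)) : ℝ) - turn (y j * -x))))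
      (∑ j, ((Q : ℂ) ^ 2 * ((Real.cosh (s * x) : ℝ) - turn (y j * x))).re)
      (planeMul h fun j => turn (y j * x))
      (planeVec h fun j => (Q : ℂ) * ((Real.exp (-(s * x)) : ℝ) - turn (y j * x)))
      (Real.exp (-(s * x))) := by
  rw [planeFlow, hor_mul_lev_mul_hor_inv]
  have hneg : ∀ w : Fin l → ℂ, -planeVec h w = planeVec h (fun j => -w j) := fun w => by
    simpa using (planeVec_smul h (-1) w).symm
  congr 1
  · rw [star_trivial, ← Matrix.mulVec_transpose, planeMul_transpose, planeMul_mulVec,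
      ← planeVec_smul, sub_eq_add_neg, hneg, ← planeVec_add]
    congr 1
    ext j
    have h1 : turn (y j * -x) = star (turn (y j * x)) := by rw [← turn_neg]; ring_nf
    rw [h1]
    simp only [Pi.add_apply, Pi.mul_apply, Pi.star_apply]
    ring_nf
  · rw [star_trivial, planeMul_mulVec, dotProduct_planeVec, dotProduct_planeVec, Finset.sum_div,
      Finset.mul_sum, ← Finset.sum_sub_distrib]
    refine Finset.sum_congr rfl fun j _ => ?_
    rw [Real.cosh_eq, ← Complex.ofReal_pow, Complex.re_ofReal_mul]
    simp only [Pi.mul_apply, Complex.star_def, Complex.conj_ofReal, Complex.re_ofReal_mul,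
      Complex.ofReal_re, Complex.sub_re, Complex.re_mul_ofReal]
    ring
  · rw [planeMul_mulVec, ← planeVec_smul, sub_eq_add_neg, hneg, ← planeVec_add]
    congr 1
    ext j
    simp only [Pi.add_apply, Pi.mul_apply]
    ring

/-- There is no vertical direction over the reals: the height is a real part, and the possibly
divergent linear term in `tendsto_height` is imaginary. No condition on the sum of the remainders is
needed. -/
theorem tendsto_conj_planeFlow {Q : ℕ → ℝ} (hQ : Tendsto Q atTop atTop) {s : ℕ → ℝ}
    {y : ℕ → Fin l → ℝ} {x : ℕ → ℝ} {η : ℝ} {ξ : Fin l → ℝ}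
    (hσ : Tendsto (fun n => Q n * (s n * x n)) atTop (𝓝 η)) {δ : ℕ → Fin l → ℝ}
    (hδint : ∀ n j, ∃ m : ℤ, y n j * x n - δ n j = m)
    (hδ : ∀ j, Tendsto (fun n => Q n * δ n j) atTop (𝓝 (ξ j))) :
    Tendsto (fun n => hor (planeVec h fun _ => (Q n : ℂ)) 0 *
      planeFlow h (s n) (y n) (x n) * (hor (planeVec h fun _ => (Q n : ℂ)) 0)⁻¹) atTop
      (𝓝 (hor (planeVec h fun j => -(η + 2 * Real.pi * ξ j * Complex.I)) 0)) := by
  have hturn : ∀ n j, turn (y n j * x n) = turn (δ n j) := fun n j => by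
    obtain ⟨m, hm⟩ := hδint n j
    exact turn_eq_of_sub_eq_int hm
  have hturn' : ∀ n j, turn (y n j * -x n) = turn (-δ n j) := fun n j => by
    rw [mul_neg, turn_neg, turn_neg, hturn]
  rw [SUform.tendsto_iff, hor_val]
  simp only [hor_mul_planeFlow_mul_inv_val, hturn, hturn']
  have hσ0 : Tendsto (fun n => s n * x n) atTop (𝓝 0) :=
    tendsto_zero_of_mul_tendsto (𝕜 := ℝ) hQ hσ
  have hvec : ∀ {w : ℕ → Fin l → ℂ} {w' : Fin l → ℂ}, (∀ j, Tendsto (w · j) atTop (𝓝 (w' j))) →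
      ∀ i, Tendsto (fun n => planeVec h (w n) i) atTop (𝓝 (planeVec h w' i)) := by
    intro w w' hw i
    exact (((continuous_apply i).comp (continuous_planeVec h)).tendsto w').comp
      (tendsto_pi_nhds.2 hw)
  refine tendsto_blk ?_ ?_ ?_ ?_ ?_ ?_
  · simpa [Function.comp_def] using (Real.continuous_exp.tendsto 0).comp hσ0
  · rw [star_trivial]
    refine hvec fun j => ?_
    have h1 : Tendsto (fun n => Q n * (s n * -x n)) atTop (𝓝 (-η)) := by
      simpa using hσ.neg
    have h2 : Tendsto (fun n => Q n * -δ n j) atTop (𝓝 (-ξ j)) := by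
      simpa using (hδ j).neg
    convert (tendsto_displacement hQ h1 h2).neg using 2
    push_cast
    ring
  · have h1 : ∀ j, Tendsto (fun n => ((Q n : ℂ) ^ 2 *
        (((Real.cosh (s n * x n) : ℝ) : ℂ) - turn (δ n j))).re) atTop
        (𝓝 ((η ^ 2 + (2 * Real.pi * ξ j) ^ 2) / 2)) := by
      intro j
      have h2 := (Complex.continuous_re.tendsto _).comp (tendsto_height hQ hσ (hδ j))
      have h3 : (((η : ℂ) ^ 2 + (2 * Real.pi * ξ j) ^ 2) / 2).re =
          (η ^ 2 + (2 * Real.pi * ξ j) ^ 2) / 2 := by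
        rw [← Complex.ofReal_re ((η ^ 2 + (2 * Real.pi * ξ j) ^ 2) / 2)]
        push_cast
        rfl
      rw [h3] at h2
      refine h2.congr fun n => ?_
      rw [Function.comp_apply, ← Complex.ofReal_pow, Complex.re_ofReal_mul, Complex.re_ofReal_mul]
      simp
    convert tendsto_finsetSum Finset.univ fun j _ => h1 j using 2
    rw [horHeight, star_trivial, dotProduct_planeVec, Finset.sum_div]
    simp only [RCLike.ofReal_real_eq_id, id, zero_mul, add_zero]
    refine Finset.sum_congr rfl fun j _ => ?_
    rw [Complex.star_def, ← Complex.normSq_eq_conj_mul_self, Complex.ofReal_re,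
      Complex.normSq_apply]
    simp
    ring
  · intro i j
    have h1 := ((continuous_planeMul h).matrix_elem i j).tendsto 1
    rw [planeMul_one] at h1
    refine h1.comp (tendsto_pi_nhds.2 fun j => ?_)
    have h2 := (continuous_turn.tendsto 0).comp
      (tendsto_zero_of_mul_tendsto (𝕜 := ℝ) hQ (hδ j))
    rwa [turn_zero] at h2
  · exact hvec fun j => tendsto_displacement hQ hσ (hδ j)
  · have := (Real.continuous_exp.tendsto (-0)).comp hσ0.neg
    simpa [Function.comp_def] using this

end Real

/-! ### The limit group in the real case -/

section RealTheorem

variable {k l : ℕ}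

section

variable (h : 2 * l ≤ k)

/-- The loxodromic one-parameter groups whose lattices degenerate. -/
noncomputable def reFlow (Q : ℕ) (x : ℝ) : SUform ℝ k :=
  hor (planeVec h fun _ => ((Q : ℝ) : ℂ)) 0 *
    planeFlow h (1 / (Q : ℝ) ^ (l + 1)) (fun j => 1 / (Q : ℝ) ^ ((j : ℕ) + 1)) x *
    (hor (planeVec h fun _ => ((Q : ℝ) : ℂ)) 0)⁻¹

theorem reFlow_zpow (Q : ℕ) (m : ℤ) : reFlow h Q 1 ^ m = reFlow h Q m := by
  rw [reFlow, conj_zpow', zpow_eq_of_map_add (planeFlow_add h _ _)]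
  rfl

theorem isConvexCocompact_reFlow {Q : ℕ} (hQ : 0 < Q) :
    IsConvexCocompact ℝ k (zpowersHom (SUform ℝ k) (reFlow h Q 1)) := by
  refine isConvexCocompact_zpowersHom_conj_lev _ _ _ _ _ _ _ ?_
  rw [Real.norm_eq_abs, Real.abs_exp, Real.one_lt_exp_iff]
  positivity

theorem exists_bounded_digits_reFlow (hl : 1 ≤ l) {Q : ℕ → ℕ}
    (hQ : Tendsto (fun n => (Q n : ℝ)) atTop atTop) {K : Set (SUform ℝ k)} (hK : IsCompact K) :
    ∃ C : ℕ, ∀ᶠ n in atTop, ∀ m : ℤ, reFlow h (Q n) m ∈ K → ∃ a : Fin (l + 1) → ℤ,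
      (∀ i, |a i| ≤ C) ∧ m = ∑ i, a i * (Q n ^ (i : ℕ) : ℕ) := by
  obtain ⟨R, hR, hKR⟩ := SUform.exists_norm_le hK
  refine ⟨⌈2 * (4 * R)⌉₊, ?_⟩
  filter_upwards [hQ.eventually_ge_atTop (4 * R)] with n hn m hm
  have hQ0 : (0 : ℝ) < Q n := by linarith
  have hent := hKR _ hm
  simp only [reFlow, hor_mul_planeFlow_mul_inv_val] at hent
  -- Real and imaginary parts are separate matrix entries, each at most `R`; hence `2 * R` here and
  -- the threshold `4 * R` for `Q`.
  have hdisp : ∀ j : Fin l, Q n * ‖((Real.exp (-(1 / (Q n : ℝ) ^ (l + 1) * m)) : ℝ) : ℂ) -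
      turn (1 / (Q n : ℝ) ^ ((j : ℕ) + 1) * m)‖ ≤ 2 * R := by
    intro j
    have h1 := hent (midx ((planeEquiv h).symm (.inl (.inl j)))) (Fin.last _)
    have h2 := hent (midx ((planeEquiv h).symm (.inl (.inr j)))) (Fin.last _)
    rw [blk_mid_last, planeVec_symm_re, Real.norm_eq_abs] at h1
    rw [blk_mid_last, planeVec_symm_im, Real.norm_eq_abs] at h2
    have h3 := Complex.norm_le_abs_re_add_abs_im (((Q n : ℝ) : ℂ) *
      (((Real.exp (-(1 / (Q n : ℝ) ^ (l + 1) * m)) : ℝ) : ℂ) -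
        turn (1 / (Q n : ℝ) ^ ((j : ℕ) + 1) * m)))
    rw [norm_mul, Complex.norm_real, Real.norm_eq_abs, abs_of_pos hQ0] at h3
    linarith
  have hbase := fun j => abs_le_and_exists_int_of_norm_sub_turn_le hQ0 (by linarith) (hdisp j)
  obtain ⟨a, ha, ham⟩ := exists_digits l (fun i => Q n ^ i) (by simp)
    (fun i => pow_dvd_pow _ i.le_succ) (fun i => pow_pos (by exact_mod_cast hQ0) i)
    (show 0 ≤ 4 * R by linarith) m (by
      have h3 := (hbase ⟨0, hl⟩).1
      rw [abs_mul, abs_of_pos (by positivity)] at h3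
      rw [div_mul_eq_mul_div, one_mul, div_le_div_iff₀ (by positivity) hQ0] at h3
      refine le_of_mul_le_mul_right (h3.trans_eq ?_) hQ0
      push_cast
      ring) (by
      intro i hi
      obtain ⟨b, hb⟩ := (hbase ⟨i, hi⟩).2
      refine ⟨b, ?_⟩
      have h5 : (m : ℝ) - b * (Q n : ℝ) ^ (i + 1) =
          (1 / (Q n : ℝ) ^ (i + 1) * m - b) * (Q n : ℝ) ^ (i + 1) := by
        field_simp
      push_cast
      rw [h5, abs_mul, abs_of_pos (show (0 : ℝ) < (Q n : ℝ) ^ (i + 1) by positivity)]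
      calc _ ≤ 2 * R / Q n * (Q n : ℝ) ^ (i + 1) := by gcongr
        _ = 2 * R * (Q n : ℝ) ^ i := by field_simp; ring
        _ ≤ _ := by gcongr; linarith)
  refine ⟨a, fun i => ?_, ham⟩
  have h1 := (ha i).trans (Nat.le_ceil _)
  exact_mod_cast h1

/-- The translations of the limit group. -/
noncomputable def reTrans (a : Fin (l + 1) → ℤ) : Fin k → ℝ :=
  planeVec h fun j => -(((a (Fin.last l) : ℝ) : ℂ) +
    2 * Real.pi * ((a j.castSucc : ℝ) : ℂ) * Complex.I)

theorem reTrans_add (a a' : Fin (l + 1) → ℤ) :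
    reTrans h (a + a') = reTrans h a + reTrans h a' := by
  rw [reTrans, reTrans, reTrans, ← planeVec_add]
  congr 1
  ext j
  push_cast [Pi.add_apply]
  ring

/-- For `i < l` the exponent `Q ^ i` meets the rotation scale of plane `i`; for `i = l` all
rotations are whole turns and only the dilation contributes. -/
theorem tendsto_reFlow_zpow {Q : ℕ → ℕ} (hQ : Tendsto (fun n => (Q n : ℝ)) atTop atTop)
    (hQ0 : ∀ n, 0 < Q n) (i : Fin (l + 1)) :
    Tendsto (fun n => reFlow h (Q n) 1 ^ ((Q n ^ (i : ℕ) : ℕ) : ℤ)) atTop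
      (𝓝 (hor (reTrans h (Pi.single i 1)) 0)) := by
  simp only [reFlow_zpow]
  simp only [reFlow, reTrans]
  refine tendsto_conj_planeFlow h hQ (δ := fun n j => powFrac (Q n) i (j + 1)) ?_ ?_ ?_
  · have h1 := tendsto_mul_powFrac hQ i (l + 1)
    have h2 : (if (i : ℕ) + 1 = l + 1 then (1 : ℝ) else 0) =
        ((Pi.single i 1 : Fin (l + 1) → ℤ) (Fin.last l) : ℤ) := by
      simp only [Pi.single_apply, Fin.ext_iff, Fin.val_last]
      split_ifs <;> first | omega | simp
    rw [h2] at h1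
    refine h1.congr fun n => ?_
    rw [powFrac, if_neg (by omega)]
    push_cast
    ring
  · intro n j
    obtain ⟨m, hm⟩ := exists_int_pow_div_sub_powFrac (hQ0 n) i (j + 1)
    refine ⟨m, ?_⟩
    rw [← hm]
    push_cast
    ring
  · intro j
    have h1 := tendsto_mul_powFrac hQ i (j + 1)
    have h2 : (if (i : ℕ) + 1 = j + 1 then (1 : ℝ) else 0) =
        ((Pi.single i 1 : Fin (l + 1) → ℤ) j.castSucc : ℤ) := by
      simp only [Pi.single_apply, Fin.ext_iff, Fin.val_castSucc]
      split_ifs <;> first | omega | simp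
    rwa [h2] at h1

/-- Coordinates of the limit group. -/
noncomputable def reCoord (hl : 1 ≤ l) (g : SUform ℝ k) (i : Fin (l + 1)) : ℝ :=
  if hi : (i : ℕ) < l then
    -g.1.1 (midx ((planeEquiv h).symm (.inl (.inr ⟨i, hi⟩)))) (Fin.last _) / (2 * Real.pi)
  else -g.1.1 (midx ((planeEquiv h).symm (.inl (.inl ⟨0, hl⟩)))) (Fin.last _)

theorem continuous_reCoord (hl : 1 ≤ l) : Continuous (reCoord h hl) := by
  refine continuous_pi fun i => ?_
  unfold reCoord
  split_ifs
  · exact (SUform.continuous_apply _ _).neg.div_const _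
  · exact (SUform.continuous_apply _ _).neg

theorem reCoord_hor_reTrans (hl : 1 ≤ l) (a : Fin (l + 1) → ℤ) (i : Fin (l + 1)) :
    reCoord h hl (hor (reTrans h a) 0) i = a i := by
  have hpi := Real.pi_pos.ne'
  rw [reCoord, hor_val]
  split_ifs with hi
  · rw [blk_mid_last, reTrans, planeVec_symm_im]
    have h1 : (⟨i, hi⟩ : Fin l).castSucc = i := rfl
    simp [h1]
  · have h1 : i = Fin.last l := Fin.ext (by simp; omega)
    rw [blk_mid_last, reTrans, planeVec_symm_re, h1]
    simp

/-- The range of the path is connected and contains the identity. -/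
theorem mem_SO₀_of_continuous {f : ℝ → SUform ℝ k} (hf : Continuous f) (h0 : f 0 = 1) (x : ℝ) :
    f x ∈ SO₀ k :=
  (isPreconnected_range hf).subset_connectedComponent (x := 1) ⟨0, h0⟩ ⟨x, rfl⟩

theorem reFlow_mem_SO₀ (Q : ℕ) (x : ℝ) : reFlow h Q x ∈ SO₀ k := by
  refine mem_SO₀_of_continuous ?_ ?_ x
  · exact (continuous_const.mul (continuous_planeFlow h _ _)).mul continuous_const
  · have h1 := planeFlow_add h (1 / (Q : ℝ) ^ (l + 1)) (fun j => 1 / (Q : ℝ) ^ ((j : ℕ) + 1)) 0 0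
    rw [add_zero, left_eq_mul] at h1
    rw [reFlow, h1, mul_one, mul_inv_cancel]

theorem hor_mem_SO₀ (τ : Fin k → ℝ) : hor τ 0 ∈ SO₀ k := by
  have h1 := mem_SO₀_of_continuous (f := fun x : ℝ => hor (x • τ) 0) (k := k) ?_ ?_ 1
  · simpa using h1
  · rw [SUform.continuous_iff]
    simp only [hor_val]
    refine continuous_blk continuous_const (by fun_prop) ?_ continuous_const (by fun_prop)
      continuous_const
    unfold horHeight
    simp only [dotProduct]
    fun_prop
  · simp [hor_zero]

/-- The limit group. -/
noncomputable def reLimit : Multiplicative (Fin (l + 1) → ℤ) →* SO₀ k :=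
  MonoidHom.mk' (fun a => ⟨hor (reTrans h a.toAdd) 0, hor_mem_SO₀ _⟩) fun a b => by
    refine Subtype.ext ?_
    rw [Subgroup.coe_mul, hor_mul _ _ _ _ (by rw [star_trivial, star_trivial, dotProduct_comm]),
      ← reTrans_add, add_zero]
    rfl

end

theorem exists_cyclic_real (hl : 1 ≤ l) (h : 2 * l ≤ k) :
    ∃ (ρ : ℕ → Multiplicative ℤ →* SO₀ k) (ρ' : Multiplicative ℤ →* SO₀ k)
      (L : ClosedSubgroup (SO₀ k)),
      (∀ n, IsConvexCocompact ℝ k (ρ n)) ∧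
      ConvergesAlgebraically ρ ρ' ∧ IsDiscreteFaithful ρ' ∧
      ConvergesGeometrically ρ L ∧
      Nonempty (L.toSubgroup ≃ₜ* Multiplicative (Fin (l + 1) → ℤ)) := by
  have hQ0 : ∀ n : ℕ, 0 < n + 1 := fun n => n.succ_pos
  have hQ : Tendsto (fun n : ℕ => ((n + 1 : ℕ) : ℝ)) atTop atTop :=
    tendsto_natCast_atTop_atTop.comp (tendsto_add_atTop_nat 1)
  let g : ℕ → SO₀ k := fun n => ⟨reFlow h (n + 1) 1, reFlow_mem_SO₀ h _ _⟩
  have hcc : ∀ n, IsConvexCocompact ℝ k (zpowersHom (SO₀ k) (g n)) := fun n => by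
    refine IsConvexCocompact.of_subtype_comp ?_
    convert isConvexCocompact_reFlow h (hQ0 n)
    ext
    simp [g]
  obtain ⟨ρ', L, h1, h2, h3, h4⟩ := exists_cyclic_geometric_limit g
    (fun n i => (((n + 1) ^ (i : ℕ) : ℕ) : ℤ)) (reLimit h) (fun n => by simp)
    (fun i => by
      rw [tendsto_subtype_rng]
      exact tendsto_reFlow_zpow h hQ hQ0 i)
    (fun K hK => by
      obtain ⟨C, hC⟩ := exists_bounded_digits_reFlow h hl hQ (hK.image continuous_subtype_val)
      refine ⟨C, hC.mono fun n hn m hm => hn m ⟨_, hm, ?_⟩⟩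
      rw [← reFlow_zpow]
      rfl)
    (fun x => reCoord h hl x.1) ((continuous_reCoord h hl).comp continuous_subtype_val)
    (fun a i => reCoord_hor_reTrans h hl a i) (fun n => (hcc n).2.1)
  exact ⟨_, ρ', L, hcc, h1, h2, h3, h4⟩

end RealTheorem

theorem theoremA (k : ℕ) (hk : 2 ≤ k) :
    (∀ l₁ : ℕ, 1 ≤ l₁ → l₁ ≤ k / 2 →
      ∃ (ρ : ℕ → Multiplicative ℤ →* SO₀ k) (ρ' : Multiplicative ℤ →* SO₀ k)
        (L : ClosedSubgroup (SO₀ k)),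
        (∀ n, IsConvexCocompact ℝ k (ρ n)) ∧
        ConvergesAlgebraically ρ ρ' ∧ IsDiscreteFaithful ρ' ∧
        ConvergesGeometrically ρ L ∧
        Nonempty (L.toSubgroup ≃ₜ* Multiplicative (Fin (l₁ + 1) → ℤ))) ∧
    (∀ l₂ : ℕ, 1 ≤ l₂ → l₂ ≤ k →
      ∃ (ρ : ℕ → Multiplicative ℤ →* SUform ℂ k) (ρ' : Multiplicative ℤ →* SUform ℂ k)
        (L : ClosedSubgroup (SUform ℂ k)),
        (∀ n, IsConvexCocompact ℂ k (ρ n)) ∧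
        ConvergesAlgebraically ρ ρ' ∧ IsDiscreteFaithful ρ' ∧
        ConvergesGeometrically ρ L ∧
        Nonempty (L.toSubgroup ≃ₜ* Multiplicative (Fin (l₂ + 1) → ℤ))) :=
  ⟨fun _ h1 h2 => exists_cyclic_real h1 (by omega), fun _ h1 h2 => exists_cyclic_complex h1 h2⟩
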